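/- Let $G=(V,E)$ be a locally finite unoriented graph (multiple edges allowed) with an at most countable set of vertices $V$, and let $A,Z\subset V$ be finite, disjoint and non-empty. A flow of strength $s$ from $A$ to $Z$ is an antisymmetric function $\theta$ on oriented edges satisfying the node law $\sum_{y\sim x}\theta(\overrightarrow{xy})=0$ at every $x\in V\setminus(A\cup Z)$ and $$s=\sum_{x\in A}\sum_{y\sim x,\,y\notin A}\theta(\overrightarrow{xy})=\sum_{z\in Z}\sum_{y\sim z,\,y\notin Z}\theta(\overrightarrow{yz}).$$ A unit flow is a flow of strength $1$. For resistances $r=(r_e)_{e\in E}$, $r_e>0$, let $$\mathcal R_r(A\leftrightarrow Z)=\inf_{\theta}\sum_{e\in E}r_e\,\theta(e)^2,$$ the infimum being over unit flows $\theta$ from $A$ to $Z$, and let $\theta_r$ denote a unit flow attaining it. Assume that there is a unit flow $\theta$ from $A$ to $Z$ with $\sum_e\theta(e)^2<\infty$ (this is automatic if $G$ is connected). Let $0<a\le b<\infty$, let $(r_e)_{e\in E}$ be i.i.d. with law $\frac12\delta_a+\frac12\delta_b$, and put $f(r)=\mathcal R_r(A\leftrightarrow Z)$. Let $E_m\subset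 E$ have finite complement $E_m^c=E\setminus E_m$, and define $$\alpha_m=\sup_{e\in E_m}\mathbb E\big(r_e\theta_r(e)^2\big),\qquad \beta_m=\frac{|E_m^c|}{\mathbb E(f)},\qquad \varepsilon_m=\Big(\frac{b-a}{a}\Big)^2\alpha_m+(b-a)^2\beta_m$$ (with $\alpha_m=0$ if $E_m=\emptyset$), and $K=\max\big\{\frac{(b-a)^2}{2a},e\big\}$, where $e=\exp(1)$. If $\varepsilon_m<1$, then almost surely $\theta_r$ exists, $r_e\theta_r(e)^2$ is integrable for every edge $e$, $f$ is square integrable with $\mathbb E(f)>0$, and $$\mathrm{Var}(f)\le \frac{2K\,\mathbb E(f)}{\log\dfrac{K}{\varepsilon_m\log (K/\varepsilon_m)}},$$ where the right-hand side is read as $0$ if $\varepsilon_m=0$ (this happens only if $a=b$). -/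

import Mathlib

open MeasureTheory ProbabilityTheory
open scoped ENNReal

noncomputable section

namespace ElectricNetwork

variable {V E : Type*}

/-- Every vertex is incident with finitely many edges (multiple edges and loops are allowed). -/
def LocallyFinite (G : Graph V E) : Prop :=
  ∀ x, {e | G.Inc e x}.Finite

/-- The origin of an edge in a fixed reference orientation, chosen arbitrarily. -/
def tail (G : Graph V E) (e : G.edgeSet) : V :=
  (G.exists_isLink_of_mem_edgeSet e.2).choose

/-- The end of an edge in the same reference orientation. -/
def head (G : Graph V E) (e : G.edgeSet) : V :=
  (G.exists_isLink_of_mem_edgeSet e.2).choose_spec.choose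

theorem isLink_tail_head (G : Graph V E) (e : G.edgeSet) :
    G.IsLink e (tail G e) (head G e) :=
  (G.exists_isLink_of_mem_edgeSet e.2).choose_spec.choose_spec

/-- An antisymmetric function on oriented edges is the same thing as a real function `θ` on edges:
`θ e` is its value on `e` oriented from `tail e` to `head e`, and `-θ e` its value on the reversed
edge. `outflow G θ x S` is the sum of this antisymmetric function over all oriented edges that go
from the vertex `x` to a vertex in `S` (a finite sum in a locally finite graph). -/
def outflow (G : Graph V E) (θ : G.edgeSet → ℝ) (x : V) (S : Set V) : ℝ :=
  (∑ᶠ e ∈ {e | tail G e = x ∧ head G e ∈ S}, θ e)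
    - ∑ᶠ e ∈ {e | head G e = x ∧ tail G e ∈ S}, θ e

/-- `θ` is a flow from the finite set `A` to the finite set `Z` of strength `s`: the node law holds
off `A ∪ Z`, and the flow out of `A` and the flow into `Z` are both equal to `s`. The vertices of
`A` are wired together, as are those of `Z`. -/
structure IsFlow (G : Graph V E) (A Z : Finset V) (s : ℝ) (θ : G.edgeSet → ℝ) : Prop where
  node_law : ∀ x ∈ G.vertexSet, x ∉ A → x ∉ Z → outflow G θ x Set.univ = 0
  flow_out : ∑ x ∈ A, outflow G θ x (A : Set V)ᶜ = s
  flow_in : ∑ z ∈ Z, -outflow G θ z (Z : Set V)ᶜ = s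

/-- The energy `∑ r_e θ(e)²`, possibly infinite, for nonnegative resistances `r`. -/
def energy (G : Graph V E) (r θ : G.edgeSet → ℝ) : ℝ≥0∞ :=
  ∑' e, ENNReal.ofReal (r e * θ e ^ 2)

/-- The infimum of the energy over all flows from `A` to `Z` of strength one, in `[0, ∞]`. -/
def minEnergy (G : Graph V E) (A Z : Finset V) (r : G.edgeSet → ℝ) : ℝ≥0∞ :=
  ⨅ (θ : G.edgeSet → ℝ) (_ : IsFlow G A Z 1 θ), energy G r θ

/-- The effective resistance `R_r(A ↔ Z)` as a real number. -/
def effectiveResistance (G : Graph V E) (A Z : Finset V) (r : G.edgeSet → ℝ) : ℝ :=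
  (minEnergy G A Z r).toReal

/-- `θ` is a flow of strength one from `A` to `Z` that attains the infimum in the definition of
the effective resistance. -/
def IsMinimalFlow (G : Graph V E) (A Z : Finset V) (r θ : G.edgeSet → ℝ) : Prop :=
  IsFlow G A Z 1 θ ∧ energy G r θ = minEnergy G A Z r

open Classical in
/-- The flow `θ_r` attaining the infimum (zero if the infimum is not attained). -/
def minimalFlow (G : Graph V E) (A Z : Finset V) (r : G.edgeSet → ℝ) : G.edgeSet → ℝ :=
  if h : ∃ θ, IsMinimalFlow G A Z r θ then h.choose else 0

/-- The law `½ δ_a + ½ δ_b`. -/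
def bernoulliLaw (a b : ℝ) : Measure ℝ :=
  (2⁻¹ : ℝ≥0∞) • Measure.dirac a + (2⁻¹ : ℝ≥0∞) • Measure.dirac b

end ElectricNetwork

end

/-!
Read the resistances off independent fair coins and let `F` be the effective resistance as a
function of the coins. For every `c > 0`, the Falik–Samorodnitsky inequality (martingale
differences and the logarithmic Sobolev inequality on the cube) gives
`Var F * (1 + log c) ≤ c * ∑ e, (𝔼 |D_e F|)² + 2 * ∑ e, 𝔼 (D_e F)²`,
where `D_e F` is half the change of `F` when the coin of `e` is flipped. Using the old minimal flow
as a competitor after the flip shows that `|D_e F| ≤ (b - a) / 2 * θ(e)²`, where `θ` is the minimal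
flow for `r_e = a`. The bound `θ(e)² ≤ 1` and the identity `∑ e, r_e θ(e)² = F` turn the two sums
into multiples of `𝔼 F`, and it remains to choose `c`.

The bound `|θ(e)| ≤ 1` is proved in `ℓ²`: by orthogonality to the finite energy cycles, `√r θ` is
a limit of gradients of potentials, and a potential can be truncated to the interval between its
values at the two ends of `e`.
-/

namespace BooleanCube

/-- The right-hand side minus the left-hand side of the two-point logarithmic Sobolev inequality
for the values `t` and `u`. -/
noncomputable def twoPointDeficit (t u : ℝ) : ℝ :=
  (u - t) ^ 2 / 2 - ((u ^ 2 * Real.log (u ^ 2) + t ^ 2 * Real.log (t ^ 2)) / 2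
    - (u ^ 2 + t ^ 2) / 2 * Real.log ((u ^ 2 + t ^ 2) / 2))

theorem twoPointDeficit_comm (t u : ℝ) : twoPointDeficit t u = twoPointDeficit u t := by
  unfold twoPointDeficit
  rw [add_comm (t ^ 2), add_comm (t ^ 2 * _)]
  ring

theorem twoPointDeficit_self (t : ℝ) : twoPointDeficit t t = 0 := by
  unfold twoPointDeficit
  ring_nf

theorem continuous_twoPointDeficit (t : ℝ) : Continuous (twoPointDeficit t) := by
  have hsq : Continuous fun u : ℝ => u ^ 2 * Real.log (u ^ 2) :=
    Real.continuous_mul_log.comp (continuous_pow 2)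
  have hmean : Continuous fun u : ℝ => (u ^ 2 + t ^ 2) / 2 * Real.log ((u ^ 2 + t ^ 2) / 2) :=
    Real.continuous_mul_log.comp (by fun_prop : Continuous fun u : ℝ => (u ^ 2 + t ^ 2) / 2)
  exact (by fun_prop : Continuous fun u : ℝ => (u - t) ^ 2 / 2).sub
    (((hsq.add_const _).div_const 2).sub hmean)

theorem hasDerivAt_twoPointDeficit (t : ℝ) {u : ℝ} (hu : 0 < u) :
    HasDerivAt (twoPointDeficit t)
      (u - t - u * Real.log (u ^ 2 / ((u ^ 2 + t ^ 2) / 2))) u := by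
  have hmean : (u ^ 2 + t ^ 2) / 2 ≠ 0 := by positivity
  have hsq : u ^ 2 ≠ 0 := by positivity
  have dsq : HasDerivAt (fun v : ℝ => v ^ 2) (2 * u) u := by simpa using hasDerivAt_pow 2 u
  have dmean : HasDerivAt (fun v : ℝ => (v ^ 2 + t ^ 2) / 2) u u := by
    simpa using (dsq.add_const (t ^ 2)).div_const 2
  have dsqlog : HasDerivAt (fun v : ℝ => v ^ 2 * Real.log (v ^ 2)) _ u :=
    (Real.hasDerivAt_mul_log hsq).comp (h := fun v : ℝ => v ^ 2) u dsq
  have dmeanlog :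
      HasDerivAt (fun v : ℝ => (v ^ 2 + t ^ 2) / 2 * Real.log ((v ^ 2 + t ^ 2) / 2)) _ u :=
    (Real.hasDerivAt_mul_log hmean).comp (h := fun v : ℝ => (v ^ 2 + t ^ 2) / 2) u dmean
  have ddist : HasDerivAt (fun v : ℝ => (v - t) ^ 2 / 2) (u - t) u := by
    simpa using (((hasDerivAt_id u).sub_const t).pow 2).div_const 2
  refine (ddist.sub (((dsqlog.add_const (t ^ 2 * Real.log (t ^ 2))).div_const 2).sub
    dmeanlog)).congr_deriv ?_
  rw [Real.log_div hsq hmean]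
  ring

theorem mul_log_sq_div_mean_le_sub {t u : ℝ} (hu : 0 < u) (htu : t ≤ u) :
    u * Real.log (u ^ 2 / ((u ^ 2 + t ^ 2) / 2)) ≤ u - t := by
  have hmean : 0 < (u ^ 2 + t ^ 2) / 2 := by positivity
  obtain ⟨q, rfl⟩ : ∃ q, t = q * u := ⟨t / u, by field_simp⟩
  have hq : 0 ≤ 1 - q := sub_nonneg.2 (le_of_mul_le_mul_right (by simpa using htu) hu)
  have hexp : u ^ 2 / ((u ^ 2 + (q * u) ^ 2) / 2) ≤ Real.exp (1 - q) := by
    refine le_trans ?_ (Real.quadratic_le_exp_of_nonneg hq)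
    rw [div_le_iff₀ hmean]
    calc u ^ 2 ≤ u ^ 2 * (1 + (1 - q) ^ 4 / 4) :=
          le_mul_of_one_le_right (by positivity) (by linarith [show 0 ≤ (1 - q) ^ 4 by positivity])
      _ = (1 + (1 - q) + (1 - q) ^ 2 / 2) * ((u ^ 2 + (q * u) ^ 2) / 2) := by ring
  have hlog := Real.log_le_log (by positivity) hexp
  rw [Real.log_exp] at hlog
  calc _ ≤ u * (1 - q) := mul_le_mul_of_nonneg_left hlog hu.le
    _ = u - q * u := by ring

theorem twoPointDeficit_nonneg {t u : ℝ} (ht : 0 ≤ t) (hu : 0 ≤ u) : 0 ≤ twoPointDeficit t u := by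
  wlog htu : t ≤ u generalizing t u
  · exact twoPointDeficit_comm t u ▸ this hu ht (le_of_not_ge htu)
  have hmono : MonotoneOn (twoPointDeficit t) (Set.Ici t) := by
    refine monotoneOn_of_hasDerivWithinAt_nonneg (convex_Ici t)
      (continuous_twoPointDeficit t).continuousOn
      (fun v hv => (hasDerivAt_twoPointDeficit t ?_).hasDerivWithinAt) fun v hv => ?_
    all_goals rw [interior_Ici, Set.mem_Ioi] at hv
    · exact ht.trans_lt hv
    · exact sub_nonneg.2 (mul_log_sq_div_mean_le_sub (ht.trans_lt hv) hv.le)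
  exact (twoPointDeficit_self t).symm.le.trans (hmono Set.self_mem_Ici (Set.mem_Ici.2 htu) htu)

theorem two_point_log_sobolev {t u : ℝ} (ht : 0 ≤ t) (hu : 0 ≤ u) :
    (u ^ 2 * Real.log (u ^ 2) + t ^ 2 * Real.log (t ^ 2)) / 2
      - (u ^ 2 + t ^ 2) / 2 * Real.log ((u ^ 2 + t ^ 2) / 2) ≤ (u - t) ^ 2 / 2 :=
  sub_nonneg.1 (twoPointDeficit_nonneg ht hu)

end BooleanCube

namespace BooleanCube

section MeasureSpace

variable {α : Type*} [MeasurableSpace α] {μ : Measure α}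

/-- The entropy `Ent_μ(g) = ∫ g log g - (∫ g) log (∫ g)` of a nonnegative function `g`. -/
noncomputable def entropy (μ : Measure α) (g : α → ℝ) : ℝ :=
  ∫ x, g x * Real.log (g x) ∂μ - (∫ x, g x ∂μ) * Real.log (∫ x, g x ∂μ)

theorem le_sq_mul_log_sq {k : ℝ} (hk : 0 < k) (t : ℝ) :
    2 * (1 + Real.log k) * t ^ 2 - 2 * k * |t| ≤ t ^ 2 * Real.log (t ^ 2) := by
  rcases eq_or_ne t 0 with rfl | ht
  · simp
  have ht' : 0 < |t| := abs_pos.2 ht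
  have hlog := Real.log_le_sub_one_of_pos (div_pos hk ht')
  rw [Real.log_div hk.ne' ht'.ne'] at hlog
  rw [← sq_abs t, Real.log_pow]
  have hcancel : |t| ^ 2 * (k / |t|) = k * |t| := by field_simp
  have := mul_le_mul_of_nonneg_left hlog (sq_nonneg |t|)
  push_cast
  linarith

theorem le_integral_sq_mul_log_sq {h : α → ℝ} (hint : Integrable h μ)
    (hsq : Integrable (fun x => h x ^ 2) μ)
    (hlog : Integrable (fun x => h x ^ 2 * Real.log (h x ^ 2)) μ) {k : ℝ} (hk : 0 < k) :
    2 * (1 + Real.log k) * ∫ x, h x ^ 2 ∂μ - 2 * k * ∫ x, |h x| ∂μ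
      ≤ ∫ x, h x ^ 2 * Real.log (h x ^ 2) ∂μ := by
  rw [← integral_const_mul, ← integral_const_mul,
    ← integral_sub (hsq.const_mul _) (hint.abs.const_mul _)]
  exact integral_mono ((hsq.const_mul _).sub (hint.abs.const_mul _)) hlog
    fun x => le_sq_mul_log_sq hk (h x)

theorem integral_sq_mul_one_add_log_le {h : α → ℝ} (hint : Integrable h μ)
    (hsq : Integrable (fun x => h x ^ 2) μ)
    (hlog : Integrable (fun x => h x ^ 2 * Real.log (h x ^ 2)) μ) {c : ℝ} (hc : 0 < c) :
    (∫ x, h x ^ 2 ∂μ) * (1 + Real.log c)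
      ≤ c * (∫ x, |h x| ∂μ) ^ 2 + entropy μ fun x => h x ^ 2 := by
  by_cases hzero : h =ᵐ[μ] 0
  · have hzeros {g : ℝ → ℝ} (hg : g 0 = 0) : ∫ x, g (h x) ∂μ = 0 :=
      integral_eq_zero_of_ae (hzero.mono fun x hx => by simp [hx, hg])
    simp [entropy, hzeros (g := (· ^ 2)), hzeros (g := fun t => t ^ 2 * Real.log (t ^ 2)),
      hzeros (g := (|·|)), -Real.log_pow]
  have hbound := le_integral_sq_mul_log_sq hint hsq hlog (k := (∫ x, h x ^ 2 ∂μ) / ∫ x, |h x| ∂μ)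
  unfold entropy
  set p := ∫ x, h x ^ 2 ∂μ
  set q := ∫ x, |h x| ∂μ
  have hp : 0 < p := (integral_nonneg fun x => sq_nonneg (h x)).lt_of_ne' fun h0 => hzero <| by
    filter_upwards [(integral_eq_zero_iff_of_nonneg (fun x => sq_nonneg (h x)) hsq).1 h0] with x hx
    exact pow_eq_zero_iff two_ne_zero |>.1 hx
  have hq : 0 < q := (integral_nonneg fun x => abs_nonneg (h x)).lt_of_ne' fun h0 => hzero <| by
    filter_upwards [(integral_eq_zero_iff_of_nonneg (fun x => abs_nonneg (h x)) hint.abs).1 h0]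
      with x hx
    exact abs_eq_zero.1 hx
  have hlogc : p * (1 + Real.log (c * q ^ 2 / p)) ≤ c * q ^ 2 := by
    have := Real.log_le_sub_one_of_pos (x := c * q ^ 2 / p) (by positivity)
    rw [← le_div_iff₀' hp]
    linarith
  replace hbound := hbound (by positivity)
  rw [mul_assoc 2 (p / q), div_mul_cancel₀ _ hq.ne', Real.log_div hp.ne' hq.ne'] at hbound
  rw [Real.log_div (by positivity) hp.ne', Real.log_mul hc.ne' (by positivity),
    Real.log_pow] at hlogc
  push_cast at hlogc
  linarith

theorem sq_integral_mul_le {f g : α → ℝ}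
    (hf : Integrable (fun x => f x ^ 2) μ) (hg : Integrable (fun x => g x ^ 2) μ)
    (hfg : Integrable (fun x => f x * g x) μ) :
    (∫ x, f x * g x ∂μ) ^ 2 ≤ (∫ x, f x ^ 2 ∂μ) * ∫ x, g x ^ 2 ∂μ := by
  have hquad (t : ℝ) : 0 ≤ (∫ x, f x ^ 2 ∂μ) * (t * t) + (2 * ∫ x, f x * g x ∂μ) * t
      + ∫ x, g x ^ 2 ∂μ := by
    have : 0 ≤ ∫ x, (t * f x + g x) ^ 2 ∂μ := integral_nonneg fun x => sq_nonneg _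
    have hexp (x : α) :
        (t * f x + g x) ^ 2 = t * t * f x ^ 2 + 2 * t * (f x * g x) + g x ^ 2 := by ring
    simp only [hexp] at this
    rw [integral_add ((hf.const_mul _).fun_add (hfg.const_mul _)) hg,
      integral_add (hf.const_mul _) (hfg.const_mul _), integral_const_mul,
      integral_const_mul] at this
    linarith
  have := discrim_le_zero hquad
  unfold discrim at this
  linarith

theorem sq_sqrt_sub_sqrt_le {f g : α → ℝ}
    (hf : Integrable (fun x => f x ^ 2) μ) (hg : Integrable (fun x => g x ^ 2) μ)
    (hfg : Integrable (fun x => f x * g x) μ) :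
    (√(∫ x, f x ^ 2 ∂μ) - √(∫ x, g x ^ 2 ∂μ)) ^ 2 ≤ ∫ x, (f x - g x) ^ 2 ∂μ := by
  have hp : 0 ≤ ∫ x, f x ^ 2 ∂μ := integral_nonneg fun x => sq_nonneg _
  have hq : 0 ≤ ∫ x, g x ^ 2 ∂μ := integral_nonneg fun x => sq_nonneg _
  have hcs : ∫ x, f x * g x ∂μ ≤ √(∫ x, f x ^ 2 ∂μ) * √(∫ x, g x ^ 2 ∂μ) := by
    rw [← Real.sqrt_mul hp]
    exact Real.le_sqrt_of_sq_le (sq_integral_mul_le hf hg hfg)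
  have hexp (x : α) : (f x - g x) ^ 2 = f x ^ 2 + g x ^ 2 - 2 * (f x * g x) := by ring
  simp only [hexp]
  rw [integral_sub (hf.fun_add hg) (hfg.const_mul _), integral_add hf hg, integral_const_mul]
  linarith [sub_sq (√(∫ x, f x ^ 2 ∂μ)) (√(∫ x, g x ^ 2 ∂μ)), Real.sq_sqrt hp, Real.sq_sqrt hq]

end MeasureSpace

end BooleanCube

namespace BooleanCube

theorem integrable_of_continuous {X : Type*} [TopologicalSpace X] [CompactSpace X]
    [MeasurableSpace X] [OpensMeasurableSpace X] {μ : Measure X} [IsFiniteMeasure μ] {f : X → ℝ}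
    (hf : Continuous f) : Integrable f μ :=
  hf.integrable_of_hasCompactSupport (.of_compactSpace f)

theorem integrable_sq_of_continuous {X : Type*} [TopologicalSpace X] [CompactSpace X]
    [MeasurableSpace X] [OpensMeasurableSpace X] {μ : Measure X} [IsFiniteMeasure μ] {f : X → ℝ}
    (hf : Continuous f) : Integrable (fun x => f x ^ 2) μ :=
  integrable_of_continuous (by fun_prop)

theorem measurePreserving_piecewise {ι : Type*} [DecidableEq ι] {X : ι → Type*}
    [∀ i, MeasurableSpace (X i)] (μ : ∀ i, Measure (X i)) [∀ i, IsProbabilityMeasure (μ i)]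
    (s : Finset ι) :
    MeasurePreserving (fun p : (∀ i, X i) × (∀ i, X i) => s.piecewise p.1 p.2)
      ((Measure.infinitePi μ).prod (Measure.infinitePi μ)) (Measure.infinitePi μ) := by
  have hmeas : Measurable fun p : (∀ i, X i) × (∀ i, X i) => s.piecewise p.1 p.2 := by
    refine measurable_pi_lambda _ fun i => ?_
    by_cases hi : i ∈ s <;> simp only [Finset.piecewise, hi, if_true, if_false] <;> fun_prop
  refine ⟨hmeas, Measure.eq_infinitePi _ fun t B hB => ?_⟩
  have hpre : (fun p : (∀ i, X i) × (∀ i, X i) => s.piecewise p.1 p.2) ⁻¹' (t : Set ι).pi B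
      = ((t ∩ s : Finset ι) : Set ι).pi B ×ˢ ((t \ s : Finset ι) : Set ι).pi B := by
    ext p
    simp only [Set.mem_preimage, Set.mem_pi, Set.mem_prod, Finset.coe_inter, Finset.coe_sdiff,
      Finset.mem_coe, Set.mem_inter_iff, Set.mem_sdiff]
    refine ⟨fun h => ⟨fun i hi => ?_, fun i hi => ?_⟩, fun h i hi => ?_⟩
    · simpa [hi.2] using h i hi.1
    · simpa [hi.2] using h i hi.1
    · by_cases his : i ∈ s
      · simpa [his] using h.1 i ⟨hi, his⟩
      · simpa [his] using h.2 i ⟨hi, his⟩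
  rw [Measure.map_apply hmeas (.pi t.countable_toSet fun i _ => hB i), hpre, Measure.prod_prod,
    Measure.infinitePi_pi _ fun i _ => hB i, Measure.infinitePi_pi _ fun i _ => hB i,
    Finset.prod_inter_mul_prod_sdiff]

/-- The law of a fair coin. -/
noncomputable def fairCoin : Measure Bool :=
  (2⁻¹ : ℝ≥0∞) • Measure.dirac false + (2⁻¹ : ℝ≥0∞) • Measure.dirac true

instance : IsProbabilityMeasure fairCoin :=
  ⟨by simp [fairCoin, ENNReal.inv_two_add_inv_two]⟩

theorem integral_fairCoin (g : Bool → ℝ) : ∫ c, g c ∂fairCoin = (g true + g false) / 2 := by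
  have hint (c : Bool) : Integrable g ((2⁻¹ : ℝ≥0∞) • Measure.dirac c) :=
    (integrable_dirac (by simp)).smul_measure (by simp)
  rw [fairCoin, integral_add_measure (hint _) (hint _), integral_smul_measure,
    integral_smul_measure, integral_dirac, integral_dirac]
  simp only [ENNReal.toReal_inv, ENNReal.toReal_ofNat, smul_eq_mul]
  ring

/-- The law of independent fair coins indexed by `ι`: the uniform measure on `ι → Bool`. -/
noncomputable def coinLaw (ι : Type*) : Measure (ι → Bool) :=
  Measure.infinitePi fun _ => fairCoin

instance (ι : Type*) : IsProbabilityMeasure (coinLaw ι) :=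
  inferInstanceAs (IsProbabilityMeasure (Measure.infinitePi _))

variable {ι : Type*} [DecidableEq ι]

theorem continuous_piecewise_uncurry {s : Finset ι} :
    Continuous fun p : (ι → Bool) × (ι → Bool) => s.piecewise p.1 p.2 := by
  refine continuous_pi fun i => ?_
  by_cases hi : i ∈ s <;> simp only [Finset.piecewise, hi, if_true, if_false] <;> fun_prop

/-- Half the difference of `F` across the `i`-th coordinate. -/
noncomputable def discreteDeriv (i : ι) (F : (ι → Bool) → ℝ) (x : ι → Bool) : ℝ :=
  (F (Function.update x i true) - F (Function.update x i false)) / 2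

/-- The average of `F` over the `i`-th coordinate. -/
noncomputable def coordMean (i : ι) (F : (ι → Bool) → ℝ) (x : ι → Bool) : ℝ :=
  (F (Function.update x i true) + F (Function.update x i false)) / 2

variable {F : (ι → Bool) → ℝ} {i j : ι} {s : Finset ι}

theorem continuous_comp_update (hF : Continuous F) (i : ι) (c : Bool) :
    Continuous fun x => F (Function.update x i c) :=
  hF.comp (continuous_id.update i continuous_const)

theorem continuous_discreteDeriv (hF : Continuous F) (i : ι) : Continuous (discreteDeriv i F) :=
  ((continuous_comp_update hF i true).sub (continuous_comp_update hF i false)).div_const 2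

theorem continuous_coordMean (hF : Continuous F) (i : ι) : Continuous (coordMean i F) :=
  ((continuous_comp_update hF i true).add (continuous_comp_update hF i false)).div_const 2

theorem dependsOn_comp_update (hF : DependsOn F ↑(insert i s)) (c : Bool) :
    DependsOn (fun x => F (Function.update x i c)) (s : Set ι) := fun x y hxy => hF fun j hj => by
  rcases eq_or_ne j i with rfl | hji
  · simp
  · simpa [hji] using hxy j (Finset.mem_of_mem_insert_of_ne hj hji)

theorem dependsOn_discreteDeriv (hF : DependsOn F ↑(insert i s)) :
    DependsOn (discreteDeriv i F) (s : Set ι) := fun x y hxy => by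
  simp only [discreteDeriv, dependsOn_comp_update hF _ hxy]

theorem dependsOn_coordMean (hF : DependsOn F ↑(insert i s)) :
    DependsOn (coordMean i F) (s : Set ι) := fun x y hxy => by
  simp only [coordMean, dependsOn_comp_update hF _ hxy]

theorem discreteDeriv_comp_update (hij : i ≠ j) (c : Bool) (x : ι → Bool) :
    discreteDeriv j (fun x => F (Function.update x i c)) x
      = discreteDeriv j F (Function.update x i c) := by
  simp only [discreteDeriv, Function.update_comm hij]

theorem discreteDeriv_discreteDeriv (hij : i ≠ j) :
    discreteDeriv j (discreteDeriv i F) = discreteDeriv i (discreteDeriv j F) := by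
  funext x
  simp only [discreteDeriv, Function.update_comm hij]
  ring

theorem discreteDeriv_coordMean (hij : i ≠ j) :
    discreteDeriv j (coordMean i F) = coordMean i (discreteDeriv j F) := by
  funext x
  simp only [discreteDeriv, coordMean, Function.update_comm hij]
  ring

section Integral

variable [Countable ι]

theorem integral_prod_piecewise (hF : Continuous F) (s : Finset ι) :
    ∫ p, F (s.piecewise p.1 p.2) ∂(coinLaw ι).prod (coinLaw ι) = ∫ x, F x ∂coinLaw ι := by
  have hmp := measurePreserving_piecewise (fun _ : ι => fairCoin) s
  rw [coinLaw, ← integral_map hmp.aemeasurable hF.measurable.aestronglyMeasurable, hmp.map_eq]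

theorem integral_eq_integral_update (hF : Continuous F) (i : ι) :
    ∫ x, F x ∂coinLaw ι = (∫ x, F (Function.update x i true) ∂coinLaw ι
      + ∫ x, F (Function.update x i false) ∂coinLaw ι) / 2 := by
  have hFp : Continuous fun p : (ι → Bool) × (ι → Bool) => F (({i} : Finset ι).piecewise p.1 p.2) :=
    hF.comp continuous_piecewise_uncurry
  have hinner (y : ι → Bool) : ∫ z, F (Function.update y i (z i)) ∂coinLaw ι
      = (F (Function.update y i true) + F (Function.update y i false)) / 2 := by
    rw [← integral_fairCoin fun c => F (Function.update y i c),
      ← (measurePreserving_eval_infinitePi (fun _ : ι => fairCoin) i).map_eq,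
      integral_map (measurable_pi_apply i).aemeasurable
        (measurable_of_finite _).aestronglyMeasurable]
    rfl
  calc ∫ x, F x ∂coinLaw ι
      = ∫ p, F (({i} : Finset ι).piecewise p.1 p.2) ∂(coinLaw ι).prod (coinLaw ι) :=
        (integral_prod_piecewise hF {i}).symm
    _ = ∫ y, ∫ z, F (Function.update y i (z i)) ∂coinLaw ι ∂coinLaw ι := by
        rw [integral_prod_symm _ (integrable_of_continuous hFp)]
        simp only [Finset.piecewise_singleton]
    _ = _ := by
        simp only [hinner]
        rw [integral_div, integral_add (integrable_of_continuous (continuous_comp_update hF i true))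
          (integrable_of_continuous (continuous_comp_update hF i false))]

theorem integral_coordMean (hF : Continuous F) (i : ι) :
    ∫ x, coordMean i F x ∂coinLaw ι = ∫ x, F x ∂coinLaw ι := by
  rw [integral_eq_integral_update hF i, ← integral_add
    (integrable_of_continuous (continuous_comp_update hF i true))
    (integrable_of_continuous (continuous_comp_update hF i false)), ← integral_div]
  rfl

theorem integral_abs_coordMean_le (hF : Continuous F) (i : ι) :
    ∫ x, |coordMean i F x| ∂coinLaw ι ≤ ∫ x, |F x| ∂coinLaw ι := by
  rw [← integral_coordMean hF.abs i]
  refine integral_mono (integrable_of_continuous (continuous_coordMean hF i).abs)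
    (integrable_of_continuous (continuous_coordMean hF.abs i)) fun x => ?_
  simp only [coordMean, abs_div, Nat.abs_ofNat]
  gcongr
  exact abs_add_le _ _

theorem integral_sq_eq_coordMean_add_discreteDeriv (hF : Continuous F) (i : ι) :
    ∫ x, F x ^ 2 ∂coinLaw ι
      = ∫ x, coordMean i F x ^ 2 ∂coinLaw ι + ∫ x, discreteDeriv i F x ^ 2 ∂coinLaw ι := by
  rw [← integral_coordMean (F := fun x => F x ^ 2) (by fun_prop) i, ← integral_add
    (integrable_sq_of_continuous (continuous_coordMean hF i))
    (integrable_sq_of_continuous (continuous_discreteDeriv hF i))]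
  congr with x
  simp only [coordMean, discreteDeriv]
  ring

end Integral

end BooleanCube

namespace BooleanCube

section LogSobolev

variable {ι : Type*} {F : (ι → Bool) → ℝ}

theorem continuous_sq_mul_log_sq (hF : Continuous F) :
    Continuous fun x => F x ^ 2 * Real.log (F x ^ 2) :=
  Real.continuous_mul_log.comp (hF.pow 2)

variable [DecidableEq ι] [Countable ι] {s : Finset ι}

theorem entropy_sq_le_entropy_update (hF : Continuous F) (i : ι) :
    entropy (coinLaw ι) (fun x => F x ^ 2)
      ≤ (entropy (coinLaw ι) (fun x => F (Function.update x i true) ^ 2)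
          + entropy (coinLaw ι) fun x => F (Function.update x i false) ^ 2) / 2
        + 2 * ∫ x, discreteDeriv i F x ^ 2 ∂coinLaw ι := by
  have hF' (c : Bool) := continuous_comp_update hF i c
  have htwo := two_point_log_sobolev
    (Real.sqrt_nonneg (∫ x, F (Function.update x i false) ^ 2 ∂coinLaw ι))
    (Real.sqrt_nonneg (∫ x, F (Function.update x i true) ^ 2 ∂coinLaw ι))
  rw [Real.sq_sqrt (integral_nonneg fun x => sq_nonneg _),
    Real.sq_sqrt (integral_nonneg fun x => sq_nonneg _)] at htwo
  have hdist := sq_sqrt_sub_sqrt_le (μ := coinLaw ι) (integrable_sq_of_continuous (hF' true))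
    (integrable_sq_of_continuous (hF' false))
    (integrable_of_continuous ((hF' true).mul (hF' false)))
  have hderiv : ∫ x, discreteDeriv i F x ^ 2 ∂coinLaw ι
      = (∫ x, (F (Function.update x i true) - F (Function.update x i false)) ^ 2 ∂coinLaw ι)
        / 4 := by
    rw [← integral_div]
    congr with x
    simp only [discreteDeriv]
    ring
  simp only [entropy]
  rw [integral_eq_integral_update (continuous_sq_mul_log_sq hF) i,
    integral_eq_integral_update (F := fun x => F x ^ 2) (by fun_prop) i, hderiv]
  linarith

theorem log_sobolev (hF : Continuous F) (hs : DependsOn F (s : Set ι)) :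
    entropy (coinLaw ι) (fun x => F x ^ 2)
      ≤ 2 * ∑ i ∈ s, ∫ x, discreteDeriv i F x ^ 2 ∂coinLaw ι := by
  induction s using Finset.induction_on generalizing F with
  | empty =>
    have hconst (x : ι → Bool) : F x = F default := hs fun i hi => by simp at hi
    simp [entropy, hconst]
  | insert i s hi ih =>
    have hfiber (c : Bool) := ih (continuous_comp_update hF i c) (dependsOn_comp_update hs c)
    have hsum : ∑ j ∈ s, ∫ x, discreteDeriv j F x ^ 2 ∂coinLaw ι
        = (∑ j ∈ s, ∫ x, discreteDeriv j (fun x => F (Function.update x i true)) x ^ 2 ∂coinLaw ι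
          + ∑ j ∈ s, ∫ x, discreteDeriv j (fun x => F (Function.update x i false)) x ^ 2
            ∂coinLaw ι) / 2 := by
      rw [← Finset.sum_add_distrib, Finset.sum_div]
      refine Finset.sum_congr rfl fun j hj => ?_
      have hij : i ≠ j := fun h => hi (h ▸ hj)
      simp only [discreteDeriv_comp_update hij]
      exact integral_eq_integral_update (F := fun x => discreteDeriv j F x ^ 2)
        ((continuous_discreteDeriv hF j).pow 2) i
    rw [Finset.sum_insert hi, hsum]
    linarith [entropy_sq_le_entropy_update hF i, hfiber true, hfiber false]

theorem integral_sq_discreteDeriv (hF : Continuous F) {i j : ι} (hij : i ≠ j) :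
    ∫ x, discreteDeriv j F x ^ 2 ∂coinLaw ι
      = ∫ x, discreteDeriv j (coordMean i F) x ^ 2 ∂coinLaw ι
        + ∫ x, discreteDeriv j (discreteDeriv i F) x ^ 2 ∂coinLaw ι := by
  rw [integral_sq_eq_coordMean_add_discreteDeriv (continuous_discreteDeriv hF j) i,
    discreteDeriv_coordMean hij, discreteDeriv_discreteDeriv hij]

theorem integral_abs_discreteDeriv_coordMean_le (hF : Continuous F) {i j : ι} (hij : i ≠ j) :
    ∫ x, |discreteDeriv j (coordMean i F) x| ∂coinLaw ι
      ≤ ∫ x, |discreteDeriv j F x| ∂coinLaw ι :=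
  discreteDeriv_coordMean (F := F) hij ▸
    integral_abs_coordMean_le (continuous_discreteDeriv hF j) i

theorem integral_sq_sub_mul_one_add_log_le_of_dependsOn (hF : Continuous F)
    (hs : DependsOn F (s : Set ι)) {c : ℝ} (hc : 0 < c) :
    (∫ x, F x ^ 2 ∂coinLaw ι - (∫ x, F x ∂coinLaw ι) ^ 2) * (1 + Real.log c)
      ≤ c * ∑ i ∈ s, (∫ x, |discreteDeriv i F x| ∂coinLaw ι) ^ 2
        + 2 * ∑ i ∈ s, ∫ x, discreteDeriv i F x ^ 2 ∂coinLaw ι := by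
  induction s using Finset.induction_on generalizing F with
  | empty =>
    have hconst (x : ι → Bool) : F x = F default := hs fun i hi => by simp at hi
    simp [hconst]
  | insert i s hi ih =>
    have hcont := continuous_discreteDeriv hF
    have hmean := ih (continuous_coordMean hF i) (dependsOn_coordMean hs)
    have hderiv := (integral_sq_mul_one_add_log_le (μ := coinLaw ι)
      (integrable_of_continuous (hcont i)) (integrable_sq_of_continuous (hcont i))
      (integrable_of_continuous (continuous_sq_mul_log_sq (hcont i))) hc).trans
      (add_le_add_right (log_sobolev (hcont i) (dependsOn_discreteDeriv hs)) _)
    have hne {j : ι} (hj : j ∈ s) : i ≠ j := fun h => hi (h ▸ hj)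
    have hsq := Finset.sum_congr rfl fun j hj => integral_sq_discreteDeriv hF (hne hj)
    rw [Finset.sum_add_distrib] at hsq
    have habs := Finset.sum_le_sum fun j hj => pow_le_pow_left₀
      (integral_nonneg fun x => abs_nonneg _)
      (integral_abs_discreteDeriv_coordMean_le hF (hne hj)) 2
    have hnonneg : 0 ≤ ∫ x, discreteDeriv i F x ^ 2 ∂coinLaw ι :=
      integral_nonneg fun x => sq_nonneg _
    rw [integral_coordMean hF] at hmean
    rw [integral_sq_eq_coordMean_add_discreteDeriv hF i, Finset.sum_insert hi,
      Finset.sum_insert hi, hsq]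
    linarith [mul_le_mul_of_nonneg_left habs hc.le]

end LogSobolev

end BooleanCube

namespace BooleanCube

section Infinite

variable {ι : Type*} [DecidableEq ι] {F : (ι → Bool) → ℝ} {i : ι} {s : Finset ι}

theorem continuous_comp_piecewise (hF : Continuous F) (s : Finset ι) (z : ι → Bool) :
    Continuous fun y => F (s.piecewise z y) :=
  hF.comp (continuous_piecewise_uncurry.comp (by fun_prop : Continuous fun y => (z, y)))

/-- The conditional expectation of `F` given the coordinates in `s`, as a function of all the
coordinates. -/
noncomputable def condMean (s : Finset ι) (F : (ι → Bool) → ℝ) (z : ι → Bool) : ℝ :=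
  ∫ y, F (s.piecewise z y) ∂coinLaw ι

theorem dependsOn_condMean (F : (ι → Bool) → ℝ) (s : Finset ι) :
    DependsOn (condMean s F) (s : Set ι) := fun x y hxy => by
  have hpiece (w : ι → Bool) : s.piecewise x w = s.piecewise y w :=
    s.piecewise_congr hxy fun _ _ => rfl
  simp only [condMean, hpiece]

variable [Countable ι]

theorem continuous_condMean (hF : Continuous F) (s : Finset ι) : Continuous (condMean s F) := by
  unfold condMean
  simpa only [Measure.restrict_univ] using
    continuous_parametric_integral_of_continuous (μ := coinLaw ι)
      (f := fun z y => F (s.piecewise z y)) (hF.comp continuous_piecewise_uncurry) isCompact_univ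

theorem discreteDeriv_condMean (hF : Continuous F) (hi : i ∈ s) :
    discreteDeriv i (condMean s F) = condMean s (discreteDeriv i F) := by
  funext z
  have hint (c : Bool) := integrable_of_continuous (μ := coinLaw ι)
    (continuous_comp_piecewise hF s (Function.update z i c))
  simp only [discreteDeriv, condMean, Finset.update_piecewise_of_mem _ _ _ hi]
  rw [integral_div, integral_sub (hint true) (hint false)]

theorem integral_condMean (hF : Continuous F) (s : Finset ι) :
    ∫ z, condMean s F z ∂coinLaw ι = ∫ x, F x ∂coinLaw ι := by
  rw [← integral_prod_piecewise hF s]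
  exact (integral_prod _ (integrable_of_continuous (hF.comp continuous_piecewise_uncurry))).symm

theorem integral_abs_condMean_le (hF : Continuous F) (s : Finset ι) :
    ∫ z, |condMean s F z| ∂coinLaw ι ≤ ∫ x, |F x| ∂coinLaw ι := by
  rw [← integral_condMean hF.abs s]
  exact integral_mono (integrable_of_continuous (continuous_condMean hF s).abs)
    (integrable_of_continuous (continuous_condMean hF.abs s)) fun z => abs_integral_le_integral_abs

theorem integral_sq_condMean_le (hF : Continuous F) (s : Finset ι) :
    ∫ z, condMean s F z ^ 2 ∂coinLaw ι ≤ ∫ x, F x ^ 2 ∂coinLaw ι := by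
  rw [← integral_condMean (F := fun x => F x ^ 2) (by fun_prop) s]
  refine integral_mono (integrable_sq_of_continuous (continuous_condMean hF s))
    (integrable_of_continuous (continuous_condMean (by fun_prop) s)) fun z => ?_
  have hz := continuous_comp_piecewise hF s z
  simpa [condMean] using sq_integral_mul_le (μ := coinLaw ι) (g := fun _ => 1)
    (integrable_sq_of_continuous hz) (by fun_prop)
    (integrable_of_continuous (hz.mul continuous_const))

theorem exists_abs_le_of_continuous {X : Type*} [TopologicalSpace X] [CompactSpace X] {f : X → ℝ}
    (hf : Continuous f) : ∃ M, ∀ x, |f x| ≤ M := by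
  obtain ⟨M, hM⟩ := isCompact_univ.exists_bound_of_continuousOn hf.continuousOn
  exact ⟨M, fun x => hM x (Set.mem_univ x)⟩

theorem tendsto_condMean (hF : Continuous F) (z : ι → Bool) :
    Filter.Tendsto (fun s => condMean s F z) Filter.atTop (nhds (F z)) := by
  obtain ⟨M, hM⟩ := exists_abs_le_of_continuous hF
  have hlim (y : ι → Bool) :
      Filter.Tendsto (fun s : Finset ι => F (s.piecewise z y)) Filter.atTop (nhds (F z)) := by
    refine (hF.tendsto z).comp (tendsto_pi_nhds.2 fun i => tendsto_nhds_of_eventually_eq ?_)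
    filter_upwards [Filter.eventually_ge_atTop {i}] with s hs
    exact Finset.piecewise_eq_of_mem _ _ _ (Finset.singleton_subset_iff.1 hs)
  have := tendsto_integral_filter_of_dominated_convergence (μ := coinLaw ι) (fun _ => M)
    (.of_forall fun s => (continuous_comp_piecewise hF s z).aestronglyMeasurable)
    (.of_forall fun s => .of_forall fun y => hM _) (integrable_const M) (.of_forall hlim)
  simpa [condMean] using this

theorem tendsto_integral_sq_condMean (hF : Continuous F) :
    Filter.Tendsto (fun s => ∫ z, condMean s F z ^ 2 ∂coinLaw ι) Filter.atTop
      (nhds (∫ x, F x ^ 2 ∂coinLaw ι)) := by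
  obtain ⟨M, hM⟩ := exists_abs_le_of_continuous hF
  have hbound (s : Finset ι) (z : ι → Bool) : ‖condMean s F z ^ 2‖ ≤ M ^ 2 := by
    rw [norm_pow]
    gcongr
    simpa [condMean] using norm_integral_le_of_norm_le_const (μ := coinLaw ι)
      (f := fun y => F (s.piecewise z y)) (.of_forall fun y => hM _)
  exact tendsto_integral_filter_of_dominated_convergence (fun _ => M ^ 2)
    (.of_forall fun s => ((continuous_condMean hF s).pow 2).aestronglyMeasurable)
    (.of_forall fun s => .of_forall (hbound s)) (integrable_const _)
    (.of_forall fun z => (tendsto_condMean hF z).pow 2)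

theorem integral_sq_sub_mul_one_add_log_le (hF : Continuous F) {S D c : ℝ}
    (hS : ∀ s : Finset ι, ∑ i ∈ s, (∫ x, |discreteDeriv i F x| ∂coinLaw ι) ^ 2 ≤ S)
    (hD : ∀ s : Finset ι, ∑ i ∈ s, ∫ x, discreteDeriv i F x ^ 2 ∂coinLaw ι ≤ D) (hc : 0 < c) :
    (∫ x, F x ^ 2 ∂coinLaw ι - (∫ x, F x ∂coinLaw ι) ^ 2) * (1 + Real.log c)
      ≤ c * S + 2 * D := by
  refine le_of_tendsto (((tendsto_integral_sq_condMean hF).sub_const _).mul_const _)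
    (.of_forall fun s => ?_)
  have hcont (i : ι) := continuous_discreteDeriv hF i
  have habs : ∑ i ∈ s, (∫ x, |discreteDeriv i (condMean s F) x| ∂coinLaw ι) ^ 2 ≤ S := by
    refine le_trans (Finset.sum_le_sum fun i hi => ?_) (hS s)
    rw [discreteDeriv_condMean hF hi]
    exact pow_le_pow_left₀ (integral_nonneg fun x => abs_nonneg _)
      (integral_abs_condMean_le (hcont i) s) 2
  have hsq : ∑ i ∈ s, ∫ x, discreteDeriv i (condMean s F) x ^ 2 ∂coinLaw ι ≤ D := by
    refine le_trans (Finset.sum_le_sum fun i hi => ?_) (hD s)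
    rw [discreteDeriv_condMean hF hi]
    exact integral_sq_condMean_le (hcont i) s
  rw [← integral_condMean hF s]
  exact (integral_sq_sub_mul_one_add_log_le_of_dependsOn (continuous_condMean hF s)
    (dependsOn_condMean F s) hc).trans (by gcongr)

end Infinite

end BooleanCube

namespace ElectricNetwork

variable {V E : Type*} {G : Graph V E} {A Z : Finset V}

theorem finite_setOf_tail_or_head_mem (hG : LocallyFinite G) (T : Finset V) :
    {e : G.edgeSet | tail G e ∈ T ∨ head G e ∈ T}.Finite := by
  have hfin : (⋃ x ∈ T, {e | G.Inc e x}).Finite := T.finite_toSet.biUnion fun x _ => hG x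
  refine (hfin.preimage Subtype.val_injective.injOn).subset ?_
  rintro e (he | he)
  · exact Set.mem_biUnion he ⟨_, isLink_tail_head G e⟩
  · exact Set.mem_biUnion he ⟨_, (isLink_tail_head G e).symm⟩

theorem countable_edgeSet (hV : G.vertexSet.Countable) (hG : LocallyFinite G) :
    Countable G.edgeSet := by
  have hcount : (⋃ x ∈ G.vertexSet, {e | G.Inc e x}).Countable :=
    hV.biUnion fun x _ => (hG x).countable
  refine hcount.mono fun e he => ?_
  have hlink := isLink_tail_head G ⟨e, he⟩
  exact Set.mem_biUnion hlink.left_mem ⟨_, hlink⟩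

variable (G) in
/-- The difference operator `u ↦ (e ↦ u (tail e) - u (head e))`. -/
noncomputable def gradient : (V → ℝ) →ₗ[ℝ] (G.edgeSet → ℝ) :=
  LinearMap.funLeft ℝ ℝ (tail G) - LinearMap.funLeft ℝ ℝ (head G)

theorem gradient_apply (u : V → ℝ) (e : G.edgeSet) :
    gradient G u e = u (tail G e) - u (head G e) := rfl

theorem gradient_eq_zero {T : Finset V} {u : V → ℝ} (hu : Function.support u ⊆ T)
    {e : G.edgeSet} (he : ¬(tail G e ∈ T ∨ head G e ∈ T)) : gradient G u e = 0 := by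
  push Not at he
  rw [gradient_apply, Function.notMem_support.1 fun h => he.1 (hu h),
    Function.notMem_support.1 fun h => he.2 (hu h), sub_zero]

theorem finite_support_gradient (hG : LocallyFinite G) {u : V → ℝ}
    (hu : (Function.support u).Finite) : (Function.support (gradient G u)).Finite :=
  (finite_setOf_tail_or_head_mem hG hu.toFinset).subset fun _ he =>
    of_not_not fun h => he (gradient_eq_zero (by simp) h)

open Classical in
theorem outflow_eq_sum {x : V} {B : Finset G.edgeSet}
    (hB : ∀ e, tail G e = x ∨ head G e = x → e ∈ B) (θ : G.edgeSet → ℝ) (S : Set V) :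
    outflow G θ x S = ∑ e ∈ B, ((if tail G e = x ∧ head G e ∈ S then θ e else 0)
      - if head G e = x ∧ tail G e ∈ S then θ e else 0) := by
  have hsum {p : G.edgeSet → Prop} [DecidablePred p] (hp : ∀ e, p e → e ∈ B) :
      ∑ᶠ e ∈ {e | p e}, θ e = ∑ e ∈ B, if p e then θ e else 0 := by
    have hsupp : Function.support (Set.indicator {e | p e} θ) ⊆ B := fun e he =>
      hp e (Set.mem_of_indicator_ne_zero he)
    rw [finsum_mem_def, finsum_eq_sum_of_support_subset _ hsupp]
    simp only [Set.indicator_apply, Set.mem_ofPred_eq]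
  rw [outflow, hsum fun e he => hB e (.inl he.1), hsum fun e he => hB e (.inr he.1),
    ← Finset.sum_sub_distrib]

theorem outflow_eq_zero {x : V} (hx : x ∉ G.vertexSet) (θ : G.edgeSet → ℝ) (S : Set V) :
    outflow G θ x S = 0 := by
  classical
  refine outflow_eq_sum (B := ∅) (fun e he => (hx ?_).elim) θ S
  rcases he with rfl | rfl
  exacts [(isLink_tail_head G e).left_mem, (isLink_tail_head G e).right_mem]

theorem sum_outflow_compl (hG : LocallyFinite G) (A : Finset V) (θ : G.edgeSet → ℝ) :
    ∑ x ∈ A, outflow G θ x (A : Set V)ᶜ = ∑ x ∈ A, outflow G θ x Set.univ := by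
  classical
  have hB {x : V} (hx : x ∈ A) (e : G.edgeSet) (he : tail G e = x ∨ head G e = x) :
      e ∈ (finite_setOf_tail_or_head_mem hG A).toFinset := by
    simpa using he.imp (· ▸ hx) (· ▸ hx)
  rw [Finset.sum_congr rfl fun x hx => outflow_eq_sum (hB hx) θ _,
    Finset.sum_congr rfl fun x hx => outflow_eq_sum (hB hx) θ _]
  refine Finset.sum_comm.trans ((Finset.sum_congr rfl fun e _ => ?_).trans Finset.sum_comm)
  simp only [Finset.sum_sub_distrib, ite_and, Finset.sum_ite_eq]
  by_cases ht : tail G e ∈ A <;> by_cases hh : head G e ∈ A <;> simp [ht, hh]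

theorem sum_mul_outflow (hG : LocallyFinite G) {T : Finset V} {u : V → ℝ}
    (hu : Function.support u ⊆ T) (θ : G.edgeSet → ℝ) :
    ∑ x ∈ T, u x * outflow G θ x Set.univ = ∑' e, gradient G u e * θ e := by
  classical
  have hB {x : V} (hx : x ∈ T) (e : G.edgeSet) (he : tail G e = x ∨ head G e = x) :
      e ∈ (finite_setOf_tail_or_head_mem hG T).toFinset := by
    simpa using he.imp (· ▸ hx) (· ▸ hx)
  have hzero (x : V) : (if x ∈ T then u x else 0) = u x :=
    ite_eq_left_iff.2 fun hx => (Function.notMem_support.1 fun h => hx (hu h)).symm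
  rw [Finset.sum_congr rfl fun x hx => congrArg (u x * ·) (outflow_eq_sum (hB hx) θ _),
    tsum_eq_sum (s := (finite_setOf_tail_or_head_mem hG T).toFinset)
      fun e he => by rw [gradient_eq_zero hu (by simpa using he), zero_mul]]
  simp only [Finset.mul_sum]
  rw [Finset.sum_comm]
  refine Finset.sum_congr rfl fun e _ => ?_
  simp only [Set.mem_univ, and_true, mul_sub, Finset.sum_sub_distrib, mul_ite, mul_zero,
    Finset.sum_ite_eq, gradient_apply, sub_mul]
  rw [← hzero (tail G e), ← hzero (head G e)]
  simp only [ite_mul, zero_mul]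
  split_ifs <;> simp

variable (A Z) in
/-- Finitely supported functions on the vertices that are constant on `A` and on `Z`: the test
functions in the weak formulation `isFlow_iff` of the flow equations. -/
def testFunctions : Submodule ℝ (V → ℝ) where
  carrier := {u | (Function.support u).Finite ∧
    (∀ x ∈ A, ∀ y ∈ A, u x = u y) ∧ ∀ x ∈ Z, ∀ y ∈ Z, u x = u y}
  zero_mem' := by simp
  add_mem' {u v} hu hv := ⟨(hu.1.union hv.1).subset (Function.support_add u v),
    fun x hx y hy => congrArg₂ (· + ·) (hu.2.1 x hx y hy) (hv.2.1 x hx y hy),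
    fun x hx y hy => congrArg₂ (· + ·) (hu.2.2 x hx y hy) (hv.2.2 x hx y hy)⟩
  smul_mem' c {u} hu := ⟨hu.1.subset (Function.support_const_smul_subset c u),
    fun x hx y hy => congrArg (c * ·) (hu.2.1 x hx y hy),
    fun x hx y hy => congrArg (c * ·) (hu.2.2 x hx y hy)⟩

theorem IsFlow.tsum_gradient_mul (hG : LocallyFinite G) (hAZ : Disjoint A Z) {s : ℝ}
    {θ : G.edgeSet → ℝ} (hθ : IsFlow G A Z s θ) {u : V → ℝ} (hu : u ∈ testFunctions A Z)
    {x₀ z₀ : V} (hx₀ : x₀ ∈ A) (hz₀ : z₀ ∈ Z) :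
    ∑' e, gradient G u e * θ e = s * (u x₀ - u z₀) := by
  classical
  have hsupp : Function.support u ⊆ (hu.1.toFinset ∪ (A ∪ Z) : Finset V) := by simp
  have hzero (x : V) (_ : x ∈ hu.1.toFinset ∪ (A ∪ Z)) (hx : x ∉ A ∪ Z) :
      u x * outflow G θ x Set.univ = 0 := by
    rw [Finset.mem_union, not_or] at hx
    by_cases hxG : x ∈ G.vertexSet
    · rw [hθ.node_law x hxG hx.1 hx.2, mul_zero]
    · rw [outflow_eq_zero hxG, mul_zero]
  have hout := hθ.flow_out
  have hin := hθ.flow_in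
  rw [sum_outflow_compl hG] at hout
  rw [Finset.sum_neg_distrib, sum_outflow_compl hG] at hin
  rw [← sum_mul_outflow hG hsupp, ← Finset.sum_subset Finset.subset_union_right hzero,
    Finset.sum_union hAZ, Finset.sum_congr rfl fun x hx => by rw [hu.2.1 x hx x₀ hx₀],
    ← Finset.mul_sum, hout, Finset.sum_congr rfl fun z hz => by rw [hu.2.2 z hz z₀ hz₀],
    ← Finset.mul_sum, neg_eq_iff_eq_neg.1 hin]
  ring

theorem indicator_mem_testFunctions {T : Finset V} (hA : A ⊆ T ∨ Disjoint A T)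
    (hZ : Z ⊆ T ∨ Disjoint Z T) : Set.indicator ↑T 1 ∈ testFunctions A Z := by
  have hconst {B : Finset V} (hB : B ⊆ T ∨ Disjoint B T) :
      ∀ x ∈ B, ∀ y ∈ B, Set.indicator (T : Set V) (1 : V → ℝ) x = Set.indicator ↑T 1 y := by
    intro x hx y hy
    rcases hB with hB | hB
    · simp [hB hx, hB hy]
    · simp [Finset.disjoint_left.1 hB hx, Finset.disjoint_left.1 hB hy]
  exact ⟨T.finite_toSet.subset Set.support_indicator_subset, hconst hA, hconst hZ⟩

theorem isFlow_iff (hG : LocallyFinite G) (hAZ : Disjoint A Z) {x₀ z₀ : V} (hx₀ : x₀ ∈ A)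
    (hz₀ : z₀ ∈ Z) {s : ℝ} {θ : G.edgeSet → ℝ} :
    IsFlow G A Z s θ ↔
      ∀ u ∈ testFunctions A Z, ∑' e, gradient G u e * θ e = s * (u x₀ - u z₀) := by
  refine ⟨fun hθ u hu => hθ.tsum_gradient_mul hG hAZ hu hx₀ hz₀, fun H => ?_⟩
  have hsum (T : Finset V) (hA : A ⊆ T ∨ Disjoint A T) (hZ : Z ⊆ T ∨ Disjoint Z T) :
      ∑ x ∈ T, outflow G θ x Set.univ
        = s * (Set.indicator (T : Set V) 1 x₀ - Set.indicator (T : Set V) 1 z₀) := by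
    rw [← H _ (indicator_mem_testFunctions hA hZ), ← sum_mul_outflow hG
      Set.support_indicator_subset]
    exact Finset.sum_congr rfl fun x hx => by simp [hx]
  refine ⟨fun x _ hxA hxZ => ?_, ?_, ?_⟩
  · have := hsum {x} (.inr (by simpa using hxA)) (.inr (by simpa using hxZ))
    have hne : x₀ ≠ x ∧ z₀ ≠ x := ⟨fun h => hxA (h ▸ hx₀), fun h => hxZ (h ▸ hz₀)⟩
    simpa [hne] using this
  · rw [sum_outflow_compl hG, hsum A (.inl subset_rfl) (.inr hAZ.symm)]
    simp [hx₀, Finset.disjoint_right.1 hAZ hz₀]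
  · rw [Finset.sum_neg_distrib, sum_outflow_compl hG, hsum Z (.inr hAZ) (.inl subset_rfl)]
    simp [hz₀, Finset.disjoint_left.1 hAZ hx₀]

end ElectricNetwork

namespace ElectricNetwork

variable {V E : Type*} {G : Graph V E} {A Z : Finset V} {r s θ φ : G.edgeSet → ℝ}

theorem memℓp_two_iff {ι : Type*} {φ : ι → ℝ} : Memℓp φ 2 ↔ Summable fun i => φ i ^ 2 := by
  rw [memℓp_gen_iff (by norm_num)]
  simp

theorem exists_lp_eq_sqrt_mul (hr : ∀ e, 0 ≤ r e) (hθ : Summable fun e => r e * θ e ^ 2) :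
    ∃ ψ : lp (fun _ : G.edgeSet => ℝ) 2, ∀ e, ψ e = √(r e) * θ e :=
  ⟨⟨_, memℓp_two_iff.2 (by simpa only [mul_pow, Real.sq_sqrt (hr _)] using hθ)⟩, fun _ => rfl⟩

theorem summable_mul_div_sqrt_sq (hr : ∀ e, 0 < r e) (ψ : lp (fun _ : G.edgeSet => ℝ) 2) :
    Summable fun e => r e * (ψ e / √(r e)) ^ 2 := by
  simpa only [div_pow, Real.sq_sqrt (hr _).le, mul_div_cancel₀ _ (hr _).ne'] using
    memℓp_two_iff.1 (lp.memℓp ψ)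

theorem hasSum_lp_inner {ι : Type*} (φ ψ : lp (fun _ : ι => ℝ) 2) :
    HasSum (fun i => φ i * ψ i) (inner ℝ φ ψ) := by
  simpa [mul_comm] using lp.hasSum_inner (𝕜 := ℝ) φ ψ

variable (A Z r) in
/-- The gradients of test functions, as a subspace of `ℓ²`. The division by `√r` turns the `ℓ²`
inner product with `√r θ` into the pairing of the gradient with `θ`. -/
noncomputable def gradientSpace : Submodule ℝ (lp (fun _ : G.edgeSet => ℝ) 2) where
  carrier := {ψ | ∃ u ∈ testFunctions A Z, ∀ e, ψ e = gradient G u e / √(r e)}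
  zero_mem' := ⟨0, zero_mem _, fun e => by simp⟩
  add_mem' := by
    rintro _ _ ⟨u, hu, hφ⟩ ⟨v, hv, hψ⟩
    exact ⟨u + v, add_mem hu hv, fun e => by simp [hφ, hψ, add_div]⟩
  smul_mem' := by
    rintro c _ ⟨u, hu, hψ⟩
    exact ⟨c • u, Submodule.smul_mem _ c hu, fun e => by simp [hψ, mul_div_assoc]⟩

theorem exists_mem_gradientSpace (hG : LocallyFinite G) (r : G.edgeSet → ℝ) {u : V → ℝ}
    (hu : u ∈ testFunctions A Z) :
    ∃ χ ∈ gradientSpace A Z r, ∀ e, χ e = gradient G u e / √(r e) := by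
  have hfin : (Function.support fun e => (gradient G u e / √(r e)) ^ 2).Finite :=
    (finite_support_gradient hG hu.1).subset fun e he h => he (by simp [h])
  exact ⟨⟨_, memℓp_two_iff.2 (summable_of_hasFiniteSupport hfin)⟩, ⟨u, hu, fun _ => rfl⟩,
    fun _ => rfl⟩

theorem inner_eq_tsum_gradient_mul {u : V → ℝ} {χ : lp (fun _ : G.edgeSet => ℝ) 2}
    (hχ : ∀ e, χ e = gradient G u e / √(r e)) (ψ : lp (fun _ : G.edgeSet => ℝ) 2) :
    inner ℝ χ ψ = ∑' e, gradient G u e * (ψ e / √(r e)) := by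
  rw [← (hasSum_lp_inner χ ψ).tsum_eq]
  exact tsum_congr fun e => by rw [hχ, div_mul_eq_mul_div, mul_div_assoc]

section Flow

variable (hG : LocallyFinite G) (hAZ : Disjoint A Z) (hA : A.Nonempty) (hZ : Z.Nonempty)
include hG hAZ hA hZ

theorem IsFlow.sub {s t : ℝ} (hθ : IsFlow G A Z s θ) (hφ : IsFlow G A Z t φ) :
    IsFlow G A Z (s - t) fun e => θ e - φ e := by
  obtain ⟨x₀, hx₀⟩ := hA
  obtain ⟨z₀, hz₀⟩ := hZ
  rw [isFlow_iff hG hAZ hx₀ hz₀] at *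
  intro u hu
  have hsum (η : G.edgeSet → ℝ) : Summable fun e => gradient G u e * η e :=
    summable_of_hasFiniteSupport <|
      (finite_support_gradient hG hu.1).subset (Function.support_mul_subset_left _ η)
  simp only [mul_sub, sub_mul]
  rw [(hsum θ).tsum_sub (hsum φ), hθ u hu, hφ u hu]
  ring

theorem mem_orthogonal_gradientSpace_iff (ψ : lp (fun _ : G.edgeSet => ℝ) 2) :
    ψ ∈ (gradientSpace A Z r)ᗮ ↔ IsFlow G A Z 0 fun e => ψ e / √(r e) := by
  obtain ⟨x₀, hx₀⟩ := hA
  obtain ⟨z₀, hz₀⟩ := hZ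
  rw [isFlow_iff hG hAZ hx₀ hz₀, Submodule.mem_orthogonal]
  constructor
  · intro h u hu
    obtain ⟨χ, hχmem, hχ⟩ := exists_mem_gradientSpace hG r hu
    rw [← inner_eq_tsum_gradient_mul hχ, h χ hχmem, zero_mul]
  · rintro h χ ⟨u, hu, hχ⟩
    rw [inner_eq_tsum_gradient_mul hχ, h u hu, zero_mul]

end Flow

variable (G A Z r θ) in
/-- `θ` is the unit current flow: a unit flow of finite energy that satisfies Kirchhoff's cycle law
in the weak form that it is orthogonal to the differences with all other unit flows of finite
energy. -/
structure IsCurrent : Prop where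
  isFlow : IsFlow G A Z 1 θ
  summable : Summable fun e => r e * θ e ^ 2
  hasSum_mul_sub : ∀ φ, IsFlow G A Z 1 φ → Summable (fun e => r e * φ e ^ 2) →
    HasSum (fun e => r e * θ e * (φ e - θ e)) 0

section Existence

variable (hG : LocallyFinite G) (hAZ : Disjoint A Z) (hA : A.Nonempty) (hZ : Z.Nonempty)
  (hr : ∀ e, 0 < r e)
include hG hAZ hA hZ hr

theorem exists_isCurrent (hφ : IsFlow G A Z 1 φ) (hφr : Summable fun e => r e * φ e ^ 2) :
    ∃ θ, IsCurrent G A Z r θ := by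
  have hs (e : G.edgeSet) : √(r e) ≠ 0 := (Real.sqrt_pos.2 (hr e)).ne'
  set K := (gradientSpace A Z r).topologicalClosure with hK
  have : CompleteSpace K := Submodule.isClosed_topologicalClosure _ |>.completeSpace_coe
  have horth (ξ : lp (fun _ : G.edgeSet => ℝ) 2) :
      ξ ∈ Kᗮ ↔ IsFlow G A Z 0 fun e => ξ e / √(r e) := by
    rw [hK, Submodule.orthogonal_closure, mem_orthogonal_gradientSpace_iff hG hAZ hA hZ]
  obtain ⟨ψ₀, hψ₀⟩ := exists_lp_eq_sqrt_mul (fun e => (hr e).le) hφr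
  set ψ := K.starProjection ψ₀
  have hsub {η : G.edgeSet → ℝ} {ξ : lp (fun _ : G.edgeSet => ℝ) 2} (hξ : ∀ e, ξ e = √(r e) * η e)
      (e : G.edgeSet) : (ξ - ψ) e / √(r e) = η e - ψ e / √(r e) := by
    rw [lp.coeFn_sub, Pi.sub_apply, sub_div, hξ, mul_div_cancel_left₀ _ (hs e)]
  have hflow : IsFlow G A Z 1 fun e => ψ e / √(r e) := by
    have h : ψ₀ - ψ ∈ Kᗮ := Submodule.sub_starProjection_mem_orthogonal ψ₀
    simp only [horth, hsub hψ₀] at h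
    simpa using hφ.sub hG hAZ hA hZ h
  refine ⟨fun e => ψ e / √(r e), hflow, summable_mul_div_sqrt_sq hr ψ, fun η hη hηr => ?_⟩
  obtain ⟨ξ, hξ⟩ := exists_lp_eq_sqrt_mul (fun e => (hr e).le) hηr
  have hmem : ξ - ψ ∈ Kᗮ := by
    rw [horth]
    simpa only [hsub hξ, sub_self] using hη.sub hG hAZ hA hZ hflow
  have hinner : inner ℝ ψ (ξ - ψ) = 0 :=
    (Submodule.mem_orthogonal _ _).1 hmem ψ (Submodule.starProjection_apply_mem K ψ₀)
  rw [← hinner]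
  refine (hasSum_lp_inner ψ (ξ - ψ)).congr_fun fun e => ?_
  rw [← hsub hξ, mul_assoc, div_mul_div_comm, Real.mul_self_sqrt (hr e).le,
    mul_div_cancel₀ _ (hr e).ne']

theorem IsCurrent.mem_closure_gradientSpace (hθ : IsCurrent G A Z r θ)
    {ψ : lp (fun _ : G.edgeSet => ℝ) 2} (hψ : ∀ e, ψ e = √(r e) * θ e) :
    ψ ∈ (gradientSpace A Z r).topologicalClosure := by
  have hs (e : G.edgeSet) : √(r e) ≠ 0 := (Real.sqrt_pos.2 (hr e)).ne'
  rw [← Submodule.orthogonal_orthogonal_eq_closure, Submodule.mem_orthogonal]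
  intro η hη
  rw [mem_orthogonal_gradientSpace_iff hG hAZ hA hZ] at hη
  have hflow := hθ.isFlow.sub hG hAZ hA hZ hη
  rw [sub_zero] at hflow
  have hsum : Summable fun e => r e * (θ e - η e / √(r e)) ^ 2 := by
    refine (summable_mul_div_sqrt_sq hr (ψ - η)).congr fun e => ?_
    rw [lp.coeFn_sub, Pi.sub_apply, hψ, sub_div, mul_div_cancel_left₀ _ (hs e)]
  have horth := (hθ.hasSum_mul_sub _ hflow hsum).neg
  rw [neg_zero] at horth
  refine (hasSum_lp_inner η ψ).unique (horth.congr_fun fun e => ?_)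
  have hsq : r e = √(r e) * √(r e) := (Real.mul_self_sqrt (hr e).le).symm
  rw [hψ, sub_sub_cancel_left, mul_neg, neg_neg]
  nth_rw 2 [hsq]
  field_simp [hs e]

end Existence

section MaximumPrinciple

theorem sq_projIcc_sub_projIcc_le {l h : ℝ} (hlh : l ≤ h) (s t : ℝ) :
    ((Set.projIcc l h hlh s : ℝ) - Set.projIcc l h hlh t) ^ 2
      ≤ (Set.projIcc l h hlh s - Set.projIcc l h hlh t) * (s - t) := by
  wlog hts : t ≤ s generalizing s t
  · linarith [this t s (le_of_not_ge hts)]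
  have hmono : (Set.projIcc l h hlh t : ℝ) ≤ Set.projIcc l h hlh s := Set.monotone_projIcc hlh hts
  have hle := (le_abs_self _).trans (Set.abs_projIcc_sub_projIcc hlh (c := s) (d := t))
  rw [abs_of_nonneg (sub_nonneg.2 hts)] at hle
  rw [sq]
  exact mul_le_mul_of_nonneg_left hle (sub_nonneg.2 hmono)

/-- Truncation of the potential of `φ` to the interval between its values at the two ends of `e`. -/
theorem exists_truncation (hG : LocallyFinite G) (hr : ∀ e, 0 < r e)
    {φ : lp (fun _ : G.edgeSet => ℝ) 2} (hφ : φ ∈ gradientSpace A Z r) (e : G.edgeSet) :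
    ∃ w ∈ testFunctions A Z, ∃ χ : lp (fun _ : G.edgeSet => ℝ) 2,
      (∀ e', χ e' = gradient G w e' / √(r e')) ∧ (∀ x y, w x - w y ≤ √(r e) * |φ e|) ∧
      χ e = φ e ∧ ∀ e', χ e' ^ 2 ≤ χ e' * φ e' := by
  obtain ⟨u, hu, hφu⟩ := hφ
  set l := min (u (tail G e)) (u (head G e))
  set h := max (u (tail G e)) (u (head G e))
  have hlh : l ≤ h := min_le_max
  set w : V → ℝ := fun x => Set.projIcc l h hlh (u x) - Set.projIcc l h hlh 0 with hw
  have hwmem : w ∈ testFunctions A Z :=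
    ⟨hu.1.subset fun x hx hux => hx (by simp [hw, hux]),
      fun x hx y hy => by simp only [hw, hu.2.1 x hx y hy],
      fun x hx y hy => by simp only [hw, hu.2.2 x hx y hy]⟩
  obtain ⟨χ, -, hχ⟩ := exists_mem_gradientSpace hG r hwmem
  have hgrad (e' : G.edgeSet) : gradient G w e' =
      Set.projIcc l h hlh (u (tail G e')) - Set.projIcc l h hlh (u (head G e')) := by
    rw [gradient_apply, hw]
    ring
  refine ⟨w, hwmem, χ, hχ, fun x y => ?_, ?_, fun e' => ?_⟩
  · have hlength : √(r e) * |φ e| = h - l := by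
      rw [hφu, abs_div, abs_of_nonneg (Real.sqrt_nonneg _),
        mul_div_cancel₀ _ (Real.sqrt_pos.2 (hr e)).ne', gradient_apply, max_sub_min_eq_abs']
    rw [hlength, hw, sub_sub_sub_cancel_right]
    exact sub_le_sub (Set.projIcc l h hlh _).2.2 (Set.projIcc l h hlh _).2.1
  · rw [hχ, hgrad, Set.projIcc_of_mem hlh ⟨min_le_left _ _, le_max_left _ _⟩,
      Set.projIcc_of_mem hlh ⟨min_le_right _ _, le_max_right _ _⟩, hφu, gradient_apply]
  · rw [hχ, hgrad, hφu, div_pow, div_mul_div_comm, ← sq]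
    exact div_le_div_of_nonneg_right (sq_projIcc_sub_projIcc_le hlh _ _) (sq_nonneg _)

variable (hG : LocallyFinite G) (hAZ : Disjoint A Z) (hA : A.Nonempty) (hZ : Z.Nonempty)
  (hr : ∀ e, 0 < r e)
include hG hAZ hA hZ hr

theorem sq_le_sqrt_mul_abs_add {ψ φ : lp (fun _ : G.edgeSet => ℝ) 2}
    (hψ : IsFlow G A Z 1 fun e => ψ e / √(r e)) (hφ : φ ∈ gradientSpace A Z r) (e : G.edgeSet) :
    φ e ^ 2 ≤ √(r e) * |φ e| + ‖φ‖ * ‖φ - ψ‖ := by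
  obtain ⟨x₀, hx₀⟩ := hA
  obtain ⟨z₀, hz₀⟩ := hZ
  rw [isFlow_iff hG hAZ hx₀ hz₀] at hψ
  obtain ⟨w, hw, χ, hχ, hosc, hχe, hcontr⟩ := exists_truncation hG hr hφ e
  have hnorm_sq : ‖χ‖ ^ 2 ≤ inner ℝ χ φ := by
    rw [← real_inner_self_eq_norm_sq]
    exact hasSum_le (fun e' => by rw [← sq]; exact hcontr e') (hasSum_lp_inner χ χ)
      (hasSum_lp_inner χ φ)
  have hnorm : ‖χ‖ ≤ ‖φ‖ := by
    have := hnorm_sq.trans (real_inner_le_norm χ φ)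
    by_contra! hlt
    nlinarith [norm_nonneg φ]
  have hψw : inner ℝ χ ψ ≤ √(r e) * |φ e| := by
    rw [inner_eq_tsum_gradient_mul hχ, hψ w hw, one_mul]
    exact hosc x₀ z₀
  calc φ e ^ 2 = ‖χ e‖ ^ 2 := by rw [hχe, Real.norm_eq_abs, sq_abs]
    _ ≤ ‖χ‖ ^ 2 := by gcongr; exact lp.norm_apply_le_norm two_ne_zero χ e
    _ ≤ inner ℝ χ ψ + inner ℝ χ (φ - ψ) := by rwa [← inner_add_right, add_sub_cancel]
    _ ≤ √(r e) * |φ e| + ‖φ‖ * ‖φ - ψ‖ :=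
      add_le_add hψw ((real_inner_le_norm _ _).trans (by gcongr))

theorem IsCurrent.abs_le_one (hθ : IsCurrent G A Z r θ) (e : G.edgeSet) : |θ e| ≤ 1 := by
  have hs : 0 < √(r e) := Real.sqrt_pos.2 (hr e)
  obtain ⟨ψ, hψ⟩ := exists_lp_eq_sqrt_mul (fun e => (hr e).le) hθ.summable
  have hflow : IsFlow G A Z 1 fun e => ψ e / √(r e) := by
    simpa [hψ, mul_div_cancel_left₀ _ (Real.sqrt_pos.2 (hr _)).ne'] using hθ.isFlow
  have hclosed : IsClosed {φ : lp (fun _ : G.edgeSet => ℝ) 2 |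
      φ e ^ 2 ≤ √(r e) * |φ e| + ‖φ‖ * ‖φ - ψ‖} := by
    have heval : Continuous fun φ : lp (fun _ : G.edgeSet => ℝ) 2 => φ e :=
      (lp.evalCLM ℝ (fun _ : G.edgeSet => ℝ) 2 e).continuous
    exact isClosed_le (heval.pow 2)
      ((heval.abs.const_mul _).add (continuous_norm.mul (continuous_id.sub continuous_const).norm))
  have hle : ψ e ^ 2 ≤ √(r e) * |ψ e| + ‖ψ‖ * ‖ψ - ψ‖ :=
    closure_minimal (fun φ hφ => sq_le_sqrt_mul_abs_add hG hAZ hA hZ hr hflow hφ e) hclosed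
      (hθ.mem_closure_gradientSpace hG hAZ hA hZ hr hψ)
  have hψe : |ψ e| = √(r e) * |θ e| := by rw [hψ, abs_mul, abs_of_pos hs]
  rw [sub_self, norm_zero, mul_zero, add_zero, ← sq_abs, hψe] at hle
  by_contra! hlt
  nlinarith [mul_pos hs hs, mul_lt_mul_of_pos_left hlt (mul_pos hs hs)]

end MaximumPrinciple

end ElectricNetwork

namespace ElectricNetwork

variable {V E : Type*} {G : Graph V E} {A Z : Finset V} {r s θ φ : G.edgeSet → ℝ} {a b : ℝ}

theorem energy_of_summable (hr : ∀ e, 0 ≤ r e) (h : Summable fun e => r e * θ e ^ 2) :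
    energy G r θ = ENNReal.ofReal (∑' e, r e * θ e ^ 2) :=
  (ENNReal.ofReal_tsum_of_nonneg (fun e => mul_nonneg (hr e) (sq_nonneg _)) h).symm

theorem summable_of_energy_ne_top (hr : ∀ e, 0 ≤ r e) (h : energy G r θ ≠ ⊤) :
    Summable fun e => r e * θ e ^ 2 :=
  (ENNReal.summable_toReal h).congr fun e =>
    ENNReal.toReal_ofReal (mul_nonneg (hr e) (sq_nonneg _))

theorem summable_mul_sq (ha : 0 ≤ a) (hr : ∀ e, r e ∈ Set.Icc a b)
    (hφ : Summable fun e => φ e ^ 2) : Summable fun e => r e * φ e ^ 2 :=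
  Summable.of_nonneg_of_le (fun e => mul_nonneg (ha.trans (hr e).1) (sq_nonneg _))
    (fun e => mul_le_mul_of_nonneg_right (hr e).2 (sq_nonneg _)) (hφ.mul_left b)

namespace IsCurrent

theorem hasSum_sub (hθ : IsCurrent G A Z r θ) (hφ : IsFlow G A Z 1 φ)
    (hφr : Summable fun e => r e * φ e ^ 2) :
    HasSum (fun e => r e * (φ e - θ e) ^ 2) (∑' e, r e * φ e ^ 2 - ∑' e, r e * θ e ^ 2) := by
  have h := (hφr.hasSum.sub hθ.summable.hasSum).sub ((hθ.hasSum_mul_sub φ hφ hφr).mul_left 2)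
  rw [mul_zero, sub_zero] at h
  exact h.congr_fun fun e => by ring

theorem tsum_le (hr : ∀ e, 0 ≤ r e) (hθ : IsCurrent G A Z r θ) (hφ : IsFlow G A Z 1 φ)
    (hφr : Summable fun e => r e * φ e ^ 2) : ∑' e, r e * θ e ^ 2 ≤ ∑' e, r e * φ e ^ 2 :=
  sub_nonneg.1 ((hθ.hasSum_sub hφ hφr).nonneg fun e => mul_nonneg (hr e) (sq_nonneg _))

theorem isMinimalFlow (hr : ∀ e, 0 ≤ r e) (hθ : IsCurrent G A Z r θ) :
    IsMinimalFlow G A Z r θ := by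
  refine ⟨hθ.isFlow, le_antisymm (le_iInf₂ fun φ hφ => ?_) (iInf₂_le θ hθ.isFlow)⟩
  by_cases h : energy G r φ = ⊤
  · exact h ▸ le_top
  · have hφr := summable_of_energy_ne_top hr h
    rw [energy_of_summable hr hθ.summable, energy_of_summable hr hφr]
    exact ENNReal.ofReal_le_ofReal (hθ.tsum_le hr hφ hφr)

theorem effectiveResistance_eq (hr : ∀ e, 0 ≤ r e) (hθ : IsCurrent G A Z r θ) :
    effectiveResistance G A Z r = ∑' e, r e * θ e ^ 2 := by
  rw [effectiveResistance, ← (hθ.isMinimalFlow hr).2, energy_of_summable hr hθ.summable,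
    ENNReal.toReal_ofReal (tsum_nonneg fun e => mul_nonneg (hr e) (sq_nonneg _))]

theorem eq_of_isMinimalFlow (hr : ∀ e, 0 < r e) (hθ : IsCurrent G A Z r θ)
    (hφ : IsMinimalFlow G A Z r φ) : φ = θ := by
  have hr' (e : G.edgeSet) : 0 ≤ r e := (hr e).le
  have henergy : energy G r φ = energy G r θ := hφ.2.trans (hθ.isMinimalFlow hr').2.symm
  have hφr : Summable fun e => r e * φ e ^ 2 := by
    refine summable_of_energy_ne_top hr' ?_
    rw [henergy, energy_of_summable hr' hθ.summable]
    exact ENNReal.ofReal_ne_top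
  have hnonneg (ψ : G.edgeSet → ℝ) (e : G.edgeSet) : 0 ≤ r e * ψ e ^ 2 :=
    mul_nonneg (hr' e) (sq_nonneg _)
  rw [energy_of_summable hr' hφr, energy_of_summable hr' hθ.summable,
    ENNReal.ofReal_eq_ofReal_iff (tsum_nonneg (hnonneg φ)) (tsum_nonneg (hnonneg θ))] at henergy
  have hzero := hθ.hasSum_sub hφ.1 hφr
  rw [henergy, sub_self,
    hasSum_zero_iff_of_nonneg fun e => mul_nonneg (hr' e) (sq_nonneg _)] at hzero
  ext e
  simpa [(hr e).ne', sub_eq_zero] using congrFun hzero e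

theorem effectiveResistance_pos (hr : ∀ e, 0 < r e) (hθ : IsCurrent G A Z r θ) :
    0 < effectiveResistance G A Z r := by
  have hnonneg (e : G.edgeSet) : 0 ≤ r e * θ e ^ 2 := mul_nonneg (hr e).le (sq_nonneg _)
  obtain ⟨e, he⟩ : ∃ e, θ e ≠ 0 := by
    by_contra! hzero
    simpa [outflow, hzero] using hθ.isFlow.flow_out
  rw [hθ.effectiveResistance_eq fun e => (hr e).le]
  exact hθ.summable.tsum_pos hnonneg e (mul_pos (hr e) (by positivity))

theorem summable_sq (ha : 0 < a) (hr : ∀ e, a ≤ r e) (hθ : IsCurrent G A Z r θ) :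
    Summable fun e => θ e ^ 2 := by
  refine Summable.of_nonneg_of_le (fun e => sq_nonneg _) (fun e => ?_) (hθ.summable.mul_left a⁻¹)
  rw [le_inv_mul_iff₀ ha]
  exact mul_le_mul_of_nonneg_right (hr e) (sq_nonneg _)

theorem tsum_mul_sub_sq_le (ha : 0 < a) (hr : ∀ e, r e ∈ Set.Icc a b)
    (hs : ∀ e, s e ∈ Set.Icc a b) (hθ : IsCurrent G A Z r θ) (hφ : IsCurrent G A Z s φ) :
    ∑' e, s e * (θ e - φ e) ^ 2 ≤ a⁻¹ * ∑' e, (s e - r e) ^ 2 * θ e ^ 2 := by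
  have hθs := summable_mul_sq ha.le hs (hθ.summable_sq ha fun e => (hr e).1)
  have hφr := summable_mul_sq ha.le hr (hφ.summable_sq ha fun e => (hs e).1)
  have hdiff := (hφ.hasSum_sub hθ.isFlow hθs).summable.hasSum
  -- Both cycle laws together turn the energy of the difference into a cross term.
  have hcross : HasSum (fun e => (s e - r e) * θ e * (θ e - φ e))
      (∑' e, s e * (θ e - φ e) ^ 2) := by
    have h := (hdiff.add (hφ.hasSum_mul_sub θ hθ.isFlow hθs)).add
      (hθ.hasSum_mul_sub φ hφ.isFlow hφr)
    rw [add_zero, add_zero] at h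
    exact h.congr_fun fun e => by ring
  have hsum : Summable fun e => (s e - r e) ^ 2 * θ e ^ 2 := by
    refine Summable.of_nonneg_of_le (fun e => by positivity) (fun e => ?_)
      ((hθ.summable_sq ha fun e => (hr e).1).mul_left ((b - a) ^ 2))
    have habs : |s e - r e| ≤ |b - a| :=
      (Real.dist_le_of_mem_Icc (hs e) (hr e)).trans (le_abs_self _)
    exact mul_le_mul_of_nonneg_right (sq_le_sq.2 habs) (sq_nonneg _)
  have hle := hasSum_le (fun e => ?_) ((hcross.mul_left 2).sub hdiff) (hsum.hasSum.mul_left a⁻¹)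
  · linarith
  have hs0 : 0 < s e := ha.trans_le (hs e).1
  calc 2 * ((s e - r e) * θ e * (θ e - φ e)) - s e * (θ e - φ e) ^ 2
      = (s e)⁻¹ * ((s e - r e) ^ 2 * θ e ^ 2)
          - (s e)⁻¹ * (s e * (θ e - φ e) - (s e - r e) * θ e) ^ 2 := by
        field_simp
        ring
    _ ≤ (s e)⁻¹ * ((s e - r e) ^ 2 * θ e ^ 2) := sub_le_self _ (by positivity)
    _ ≤ a⁻¹ * ((s e - r e) ^ 2 * θ e ^ 2) := by gcongr; exact (hs e).1

end IsCurrent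

end ElectricNetwork

namespace ElectricNetwork

/-- The standing assumptions on a network with sources `A` and sinks `Z`: it is locally finite and
carries a unit flow of finite energy, for unit resistances and hence for all bounded ones. -/
structure IsNetwork {V E : Type*} (G : Graph V E) (A Z : Finset V) : Prop where
  locallyFinite : LocallyFinite G
  disjoint : Disjoint A Z
  nonempty_left : A.Nonempty
  nonempty_right : Z.Nonempty
  exists_flow : ∃ φ, IsFlow G A Z 1 φ ∧ Summable fun e => φ e ^ 2

namespace IsNetwork

variable {V E : Type*} {G : Graph V E} {A Z : Finset V} {r : G.edgeSet → ℝ} {a b : ℝ}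

theorem isCurrent_minimalFlow (h : IsNetwork G A Z) (ha : 0 < a) (hr : ∀ e, r e ∈ Set.Icc a b) :
    IsCurrent G A Z r (minimalFlow G A Z r) := by
  obtain ⟨φ, hφ, hφs⟩ := h.exists_flow
  have hr0 (e : G.edgeSet) : 0 < r e := ha.trans_le (hr e).1
  obtain ⟨θ, hθ⟩ := exists_isCurrent h.locallyFinite h.disjoint h.nonempty_left h.nonempty_right
    hr0 hφ (summable_mul_sq ha.le hr hφs)
  have hmin : ∃ θ, IsMinimalFlow G A Z r θ := ⟨θ, hθ.isMinimalFlow fun e => (hr0 e).le⟩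
  rw [minimalFlow, dif_pos hmin]
  exact hθ.eq_of_isMinimalFlow hr0 hmin.choose_spec ▸ hθ

theorem summable_minimalFlow_sq (h : IsNetwork G A Z) (ha : 0 < a)
    (hr : ∀ e, r e ∈ Set.Icc a b) : Summable fun e => minimalFlow G A Z r e ^ 2 :=
  (h.isCurrent_minimalFlow ha hr).summable_sq ha fun e => (hr e).1

theorem effectiveResistance_eq (h : IsNetwork G A Z) (ha : 0 < a)
    (hr : ∀ e, r e ∈ Set.Icc a b) :
    effectiveResistance G A Z r = ∑' e, r e * minimalFlow G A Z r e ^ 2 :=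
  (h.isCurrent_minimalFlow ha hr).effectiveResistance_eq fun e => ha.le.trans (hr e).1

theorem minimalFlow_sq_le_one (h : IsNetwork G A Z) (ha : 0 < a) (hr : ∀ e, r e ∈ Set.Icc a b)
    (e : G.edgeSet) : minimalFlow G A Z r e ^ 2 ≤ 1 :=
  (sq_le_one_iff_abs_le_one _).2 <|
    IsCurrent.abs_le_one h.locallyFinite h.disjoint h.nonempty_left h.nonempty_right
      (fun e => ha.trans_le (hr e).1) (h.isCurrent_minimalFlow ha hr) e

theorem effectiveResistance_update_le [DecidableEq G.edgeSet] (h : IsNetwork G A Z) (ha : 0 < a)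
    (hr : ∀ e, r e ∈ Set.Icc a b) (e : G.edgeSet) {t : ℝ} (ht : t ∈ Set.Icc a b) :
    effectiveResistance G A Z (Function.update r e t)
      ≤ effectiveResistance G A Z r + (t - r e) * minimalFlow G A Z r e ^ 2 := by
  have hr' (e' : G.edgeSet) : Function.update r e t e' ∈ Set.Icc a b := by
    rcases eq_or_ne e' e with rfl | hne
    · rwa [Function.update_self]
    · rw [Function.update_of_ne hne]
      exact hr e'
  have hθ := h.isCurrent_minimalFlow ha hr
  have hθ' := summable_mul_sq ha.le hr' (h.summable_minimalFlow_sq ha hr)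
  have hdiff := (hθ'.hasSum.sub hθ.summable.hasSum).unique <|
    hasSum_single e fun e' he' => by rw [Function.update_of_ne he', sub_self]
  rw [Function.update_self] at hdiff
  calc effectiveResistance G A Z (Function.update r e t)
      = ∑' e', Function.update r e t e'
          * minimalFlow G A Z (Function.update r e t) e' ^ 2 := h.effectiveResistance_eq ha hr'
    _ ≤ ∑' e', Function.update r e t e' * minimalFlow G A Z r e' ^ 2 :=
      (h.isCurrent_minimalFlow ha hr').tsum_le (fun e => ha.le.trans (hr' e).1) hθ.isFlow hθ'
    _ = effectiveResistance G A Z r + (t - r e) * minimalFlow G A Z r e ^ 2 := by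
      rw [h.effectiveResistance_eq ha hr]
      linarith

section Continuity

open Filter Topology

theorem tendsto_tsum_mul_minimalFlow_sub_sq (h : IsNetwork G A Z) (ha : 0 < a)
    (hr : ∀ e, r e ∈ Set.Icc a b) :
    Tendsto (fun s => ∑' e, s e * (minimalFlow G A Z r e - minimalFlow G A Z s e) ^ 2)
      (𝓝[Set.univ.pi fun _ => Set.Icc a b] r) (𝓝 0) := by
  have hbox : ∀ᶠ s in 𝓝[Set.univ.pi fun _ => Set.Icc a b] r, ∀ e, s e ∈ Set.Icc a b :=
    eventually_mem_nhdsWithin.mono fun s hs e => hs e (Set.mem_univ e)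
  have hlim : Tendsto (fun s : G.edgeSet → ℝ => ∑' e, (s e - r e) ^ 2 * minimalFlow G A Z r e ^ 2)
      (𝓝[Set.univ.pi fun _ => Set.Icc a b] r) (𝓝 (∑' _ : G.edgeSet, 0)) := by
    refine tendsto_tsum_of_dominated_convergence
      ((h.summable_minimalFlow_sq ha hr).mul_left ((b - a) ^ 2)) (fun e => ?_) ?_
    · have : Continuous fun s : G.edgeSet → ℝ => (s e - r e) ^ 2 * minimalFlow G A Z r e ^ 2 := by
        fun_prop
      simpa using (this.tendsto r).mono_left nhdsWithin_le_nhds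
    · filter_upwards [hbox] with s hs e
      rw [Real.norm_of_nonneg (by positivity)]
      exact mul_le_mul_of_nonneg_right
        (sq_le_sq.2 ((Real.dist_le_of_mem_Icc (hs e) (hr e)).trans (le_abs_self _))) (sq_nonneg _)
  refine squeeze_zero' ?_ ?_ (by simpa using hlim.const_mul a⁻¹)
  · filter_upwards [hbox] with s hs
    exact tsum_nonneg fun e => mul_nonneg (ha.le.trans (hs e).1) (sq_nonneg _)
  · filter_upwards [hbox] with s hs
    exact (h.isCurrent_minimalFlow ha hr).tsum_mul_sub_sq_le ha hr hs
      (h.isCurrent_minimalFlow ha hs)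

theorem hasSum_mul_minimalFlow_sub_sq (h : IsNetwork G A Z) (ha : 0 < a)
    {s : G.edgeSet → ℝ} (hr : ∀ e, r e ∈ Set.Icc a b) (hs : ∀ e, s e ∈ Set.Icc a b) :
    HasSum (fun e => s e * (minimalFlow G A Z r e - minimalFlow G A Z s e) ^ 2)
      (∑' e, s e * minimalFlow G A Z r e ^ 2 - effectiveResistance G A Z s) := by
  rw [h.effectiveResistance_eq ha hs]
  exact (h.isCurrent_minimalFlow ha hs).hasSum_sub (h.isCurrent_minimalFlow ha hr).isFlow
    (summable_mul_sq ha.le hs (h.summable_minimalFlow_sq ha hr))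

theorem continuousOn_minimalFlow (h : IsNetwork G A Z) (ha : 0 < a) (e : G.edgeSet) :
    ContinuousOn (fun r => minimalFlow G A Z r e) (Set.univ.pi fun _ => Set.Icc a b) := by
  intro r hr
  replace hr (e : G.edgeSet) : r e ∈ Set.Icc a b := hr e (Set.mem_univ e)
  have hlim := ((h.tendsto_tsum_mul_minimalFlow_sub_sq ha hr).const_mul a⁻¹).sqrt
  rw [mul_zero, Real.sqrt_zero] at hlim
  refine tendsto_iff_norm_sub_tendsto_zero.2 (squeeze_zero' (.of_forall fun s => norm_nonneg _) ?_
    hlim)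
  filter_upwards [eventually_mem_nhdsWithin] with s hs
  replace hs (e : G.edgeSet) : s e ∈ Set.Icc a b := hs e (Set.mem_univ e)
  refine Real.abs_le_sqrt ((le_inv_mul_iff₀ ha).2 ?_)
  rw [← neg_sub, neg_sq]
  calc a * (minimalFlow G A Z r e - minimalFlow G A Z s e) ^ 2
      ≤ s e * (minimalFlow G A Z r e - minimalFlow G A Z s e) ^ 2 :=
        mul_le_mul_of_nonneg_right (hs e).1 (sq_nonneg _)
    _ ≤ _ := (h.hasSum_mul_minimalFlow_sub_sq ha hr hs).summable.le_tsum e fun e _ =>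
        mul_nonneg (ha.le.trans (hs e).1) (sq_nonneg _)

theorem continuousOn_effectiveResistance (h : IsNetwork G A Z) (ha : 0 < a) :
    ContinuousOn (effectiveResistance G A Z) (Set.univ.pi fun _ => Set.Icc a b) := by
  intro r hr
  replace hr (e : G.edgeSet) : r e ∈ Set.Icc a b := hr e (Set.mem_univ e)
  have hbox : ∀ᶠ s in 𝓝[Set.univ.pi fun _ => Set.Icc a b] r, ∀ e, s e ∈ Set.Icc a b :=
    eventually_mem_nhdsWithin.mono fun s hs e => hs e (Set.mem_univ e)
  have hlim : Tendsto (fun s : G.edgeSet → ℝ => ∑' e, s e * minimalFlow G A Z r e ^ 2)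
      (𝓝[Set.univ.pi fun _ => Set.Icc a b] r) (𝓝 (∑' e, r e * minimalFlow G A Z r e ^ 2)) := by
    refine tendsto_tsum_of_dominated_convergence
      ((h.summable_minimalFlow_sq ha hr).mul_left b) (fun e => ?_) ?_
    · have : Continuous fun s : G.edgeSet → ℝ => s e * minimalFlow G A Z r e ^ 2 := by fun_prop
      exact (this.tendsto r).mono_left nhdsWithin_le_nhds
    · filter_upwards [hbox] with s hs e
      rw [Real.norm_of_nonneg (mul_nonneg (ha.le.trans (hs e).1) (sq_nonneg _))]
      exact mul_le_mul_of_nonneg_right (hs e).2 (sq_nonneg _)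
  have hsub := hlim.sub (h.tendsto_tsum_mul_minimalFlow_sub_sq ha hr)
  rw [sub_zero, ← h.effectiveResistance_eq ha hr] at hsub
  refine hsub.congr' ?_
  filter_upwards [hbox] with s hs
  rw [(h.hasSum_mul_minimalFlow_sub_sq ha hr hs).tsum_eq, sub_sub_cancel]

end Continuity

end IsNetwork

end ElectricNetwork

namespace ElectricNetwork

open BooleanCube

/-- The resistances decided by coins: `b` on the edges showing `true`, `a` on the others. -/
noncomputable def coinResistance {ι : Type*} (a b : ℝ) (x : ι → Bool) (i : ι) : ℝ :=
  bif x i then b else a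

theorem coinResistance_mem_Icc {ι : Type*} {a b : ℝ} (hab : a ≤ b) (x : ι → Bool) (i : ι) :
    coinResistance a b x i ∈ Set.Icc a b := by
  rcases hx : x i <;> simp [coinResistance, hx, hab]

theorem continuous_coinResistance {ι : Type*} (a b : ℝ) :
    Continuous (coinResistance a b : (ι → Bool) → ι → ℝ) :=
  continuous_pi fun i =>
    (continuous_of_discreteTopology (f := fun c => bif c then b else a)).comp (continuous_apply i)

theorem coinResistance_update {ι : Type*} [DecidableEq ι] (a b : ℝ) (x : ι → Bool) (i : ι)
    (c : Bool) : coinResistance a b (Function.update x i c)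
      = Function.update (coinResistance a b x) i (bif c then b else a) := by
  funext j
  rcases eq_or_ne j i with rfl | hji
  · simp [coinResistance]
  · simp [coinResistance, hji]

section Coins

variable {V E : Type*} (G : Graph V E) (A Z : Finset V) (a b : ℝ)

/-- The effective resistance between `A` and `Z` as a function of the coins. -/
noncomputable def coinEffectiveResistance (x : G.edgeSet → Bool) : ℝ :=
  effectiveResistance G A Z (coinResistance a b x)

/-- The energy dissipated in the edge `e` by the minimal unit flow, as a function of the coins. -/
noncomputable def edgeEnergy (e : G.edgeSet) (x : G.edgeSet → Bool) : ℝ :=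
  coinResistance a b x e * minimalFlow G A Z (coinResistance a b x) e ^ 2

end Coins

namespace IsNetwork

variable {V E : Type*} {G : Graph V E} {A Z : Finset V} {a b : ℝ}

theorem continuous_coinEffectiveResistance (h : IsNetwork G A Z) (ha : 0 < a) (hab : a ≤ b) :
    Continuous (coinEffectiveResistance G A Z a b) :=
  (h.continuousOn_effectiveResistance ha).comp_continuous (continuous_coinResistance a b)
    fun x e _ => coinResistance_mem_Icc hab x e

theorem continuous_minimalFlow_coinResistance (h : IsNetwork G A Z) (ha : 0 < a) (hab : a ≤ b)
    (e : G.edgeSet) : Continuous fun x => minimalFlow G A Z (coinResistance a b x) e :=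
  (h.continuousOn_minimalFlow ha e).comp_continuous (continuous_coinResistance a b)
    fun x e _ => coinResistance_mem_Icc hab x e

theorem continuous_edgeEnergy (h : IsNetwork G A Z) (ha : 0 < a) (hab : a ≤ b)
    (e : G.edgeSet) : Continuous (edgeEnergy G A Z a b e) :=
  ((continuous_apply e).comp (continuous_coinResistance a b)).mul
    ((h.continuous_minimalFlow_coinResistance ha hab e).pow 2)

theorem edgeEnergy_nonneg (ha : 0 ≤ a) (hab : a ≤ b) (e : G.edgeSet) (x : G.edgeSet → Bool) :
    0 ≤ edgeEnergy G A Z a b e x :=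
  mul_nonneg (ha.trans (coinResistance_mem_Icc hab x e).1) (sq_nonneg _)

theorem coinEffectiveResistance_pos (h : IsNetwork G A Z) (ha : 0 < a) (hab : a ≤ b)
    (x : G.edgeSet → Bool) : 0 < coinEffectiveResistance G A Z a b x :=
  (h.isCurrent_minimalFlow ha (coinResistance_mem_Icc hab x)).effectiveResistance_pos
    fun e => ha.trans_le (coinResistance_mem_Icc hab x e).1

theorem sum_edgeEnergy_le (h : IsNetwork G A Z) (ha : 0 < a) (hab : a ≤ b)
    (s : Finset G.edgeSet) (x : G.edgeSet → Bool) :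
    ∑ e ∈ s, edgeEnergy G A Z a b e x ≤ coinEffectiveResistance G A Z a b x := by
  rw [coinEffectiveResistance, h.effectiveResistance_eq ha (coinResistance_mem_Icc hab x)]
  exact (h.isCurrent_minimalFlow ha (coinResistance_mem_Icc hab x)).summable.sum_le_tsum s
    fun e _ => edgeEnergy_nonneg ha.le hab e x

section Resampling

variable [DecidableEq G.edgeSet]

theorem abs_discreteDeriv_coinEffectiveResistance_le (h : IsNetwork G A Z) (ha : 0 < a)
    (hab : a ≤ b) (e : G.edgeSet) (x : G.edgeSet → Bool) :
    |discreteDeriv e (coinEffectiveResistance G A Z a b) x|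
      ≤ (b - a) / 2
        * minimalFlow G A Z (coinResistance a b (Function.update x e false)) e ^ 2 := by
  have hflip (c d : Bool) : coinEffectiveResistance G A Z a b (Function.update x e d)
      ≤ coinEffectiveResistance G A Z a b (Function.update x e c)
        + ((bif d then b else a) - bif c then b else a)
          * minimalFlow G A Z (coinResistance a b (Function.update x e c)) e ^ 2 := by
    have hd : (bif d then b else a) ∈ Set.Icc a b := by cases d <;> simp [hab]
    have := h.effectiveResistance_update_le ha
      (coinResistance_mem_Icc hab (Function.update x e c)) e hd
    rwa [← coinResistance_update, Function.update_idem, coinResistance, Function.update_self]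
      at this
  have hup := hflip false true
  have hdown := hflip true false
  have hnonneg : 0 ≤ (b - a)
      * minimalFlow G A Z (coinResistance a b (Function.update x e true)) e ^ 2 :=
    mul_nonneg (sub_nonneg.2 hab) (sq_nonneg _)
  simp only [cond_true, cond_false] at hup hdown
  rw [discreteDeriv, abs_of_nonneg (by linarith)]
  linarith

theorem abs_discreteDeriv_coinEffectiveResistance_le_half (h : IsNetwork G A Z) (ha : 0 < a)
    (hab : a ≤ b) (e : G.edgeSet) (x : G.edgeSet → Bool) :
    |discreteDeriv e (coinEffectiveResistance G A Z a b) x| ≤ (b - a) / 2 :=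
  (h.abs_discreteDeriv_coinEffectiveResistance_le ha hab e x).trans <|
    mul_le_of_le_one_right (by linarith)
      (h.minimalFlow_sq_le_one ha (coinResistance_mem_Icc hab _) e)

end Resampling

section Mean

variable [Countable G.edgeSet]

theorem integral_coinEffectiveResistance_pos (h : IsNetwork G A Z) (ha : 0 < a) (hab : a ≤ b) :
    0 < ∫ x, coinEffectiveResistance G A Z a b x ∂coinLaw G.edgeSet := by
  have hpos := h.coinEffectiveResistance_pos ha hab
  rw [integral_pos_iff_support_of_nonneg (fun x => (hpos x).le)
    (integrable_of_continuous (h.continuous_coinEffectiveResistance ha hab)),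
    Set.eq_univ_of_forall (s := Function.support _) fun x => (hpos x).ne', measure_univ]
  exact one_pos

theorem sum_integral_edgeEnergy_le (h : IsNetwork G A Z) (ha : 0 < a) (hab : a ≤ b)
    (s : Finset G.edgeSet) :
    ∑ e ∈ s, ∫ x, edgeEnergy G A Z a b e x ∂coinLaw G.edgeSet
      ≤ ∫ x, coinEffectiveResistance G A Z a b x ∂coinLaw G.edgeSet := by
  have hint (e : G.edgeSet) : Integrable (edgeEnergy G A Z a b e) (coinLaw G.edgeSet) :=
    integrable_of_continuous (h.continuous_edgeEnergy ha hab e)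
  rw [← integral_finsetSum _ fun e _ => hint e]
  exact integral_mono (integrable_finsetSum _ fun e _ => hint e)
    (integrable_of_continuous (h.continuous_coinEffectiveResistance ha hab))
    (h.sum_edgeEnergy_le ha hab s)

variable [DecidableEq G.edgeSet]

theorem integral_minimalFlow_update_sq_le (h : IsNetwork G A Z) (ha : 0 < a) (hab : a ≤ b)
    (e : G.edgeSet) :
    ∫ x, minimalFlow G A Z (coinResistance a b (Function.update x e false)) e ^ 2
        ∂coinLaw G.edgeSet
      ≤ 2 / a * ∫ x, edgeEnergy G A Z a b e x ∂coinLaw G.edgeSet := by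
  have hlow (x : G.edgeSet → Bool) : edgeEnergy G A Z a b e (Function.update x e false)
      = a * minimalFlow G A Z (coinResistance a b (Function.update x e false)) e ^ 2 := by
    simp [edgeEnergy, coinResistance]
  have hhigh : 0 ≤ ∫ x, edgeEnergy G A Z a b e (Function.update x e true) ∂coinLaw G.edgeSet :=
    integral_nonneg fun x => edgeEnergy_nonneg ha.le hab e _
  rw [integral_eq_integral_update (h.continuous_edgeEnergy ha hab e) e]
  simp only [hlow, integral_const_mul]
  rw [div_mul_eq_mul_div, le_div_iff₀ ha]
  linarith

theorem integral_abs_discreteDeriv_le (h : IsNetwork G A Z) (ha : 0 < a) (hab : a ≤ b)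
    (e : G.edgeSet) :
    ∫ x, |discreteDeriv e (coinEffectiveResistance G A Z a b) x| ∂coinLaw G.edgeSet
      ≤ (b - a) / a * ∫ x, edgeEnergy G A Z a b e x ∂coinLaw G.edgeSet :=
  calc ∫ x, |discreteDeriv e (coinEffectiveResistance G A Z a b) x| ∂coinLaw G.edgeSet
      ≤ ∫ x, (b - a) / 2
          * minimalFlow G A Z (coinResistance a b (Function.update x e false)) e ^ 2
          ∂coinLaw G.edgeSet :=
        integral_mono (integrable_of_continuous
            (continuous_discreteDeriv (h.continuous_coinEffectiveResistance ha hab) e).abs)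
          ((integrable_sq_of_continuous (continuous_comp_update
            (h.continuous_minimalFlow_coinResistance ha hab e) e false)).const_mul _)
          (h.abs_discreteDeriv_coinEffectiveResistance_le ha hab e)
    _ ≤ (b - a) / 2 * (2 / a * ∫ x, edgeEnergy G A Z a b e x ∂coinLaw G.edgeSet) := by
        rw [integral_const_mul]
        exact mul_le_mul_of_nonneg_left (h.integral_minimalFlow_update_sq_le ha hab e)
          (by linarith)
    _ = (b - a) / a * ∫ x, edgeEnergy G A Z a b e x ∂coinLaw G.edgeSet := by
        field_simp

theorem integral_abs_discreteDeriv_le_half (h : IsNetwork G A Z) (ha : 0 < a) (hab : a ≤ b)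
    (e : G.edgeSet) :
    ∫ x, |discreteDeriv e (coinEffectiveResistance G A Z a b) x| ∂coinLaw G.edgeSet
      ≤ (b - a) / 2 := by
  refine (integral_mono (integrable_of_continuous (continuous_discreteDeriv
    (h.continuous_coinEffectiveResistance ha hab) e).abs) (integrable_const _)
    (h.abs_discreteDeriv_coinEffectiveResistance_le_half ha hab e)).trans_eq ?_
  simp

theorem integral_discreteDeriv_sq_le (h : IsNetwork G A Z) (ha : 0 < a) (hab : a ≤ b)
    (e : G.edgeSet) :
    ∫ x, discreteDeriv e (coinEffectiveResistance G A Z a b) x ^ 2 ∂coinLaw G.edgeSet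
      ≤ (b - a) ^ 2 / (2 * a) * ∫ x, edgeEnergy G A Z a b e x ∂coinLaw G.edgeSet := by
  have hD := continuous_discreteDeriv (h.continuous_coinEffectiveResistance ha hab) e
  have hhalf : 0 ≤ (b - a) / 2 := by linarith
  calc ∫ x, discreteDeriv e (coinEffectiveResistance G A Z a b) x ^ 2 ∂coinLaw G.edgeSet
      ≤ ∫ x, (b - a) / 2 * |discreteDeriv e (coinEffectiveResistance G A Z a b) x|
          ∂coinLaw G.edgeSet := by
        refine integral_mono (integrable_sq_of_continuous hD)
          ((integrable_of_continuous hD.abs).const_mul _) fun x => ?_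
        rw [← sq_abs, sq]
        exact mul_le_mul_of_nonneg_right
          (h.abs_discreteDeriv_coinEffectiveResistance_le_half ha hab e x) (abs_nonneg _)
    _ ≤ (b - a) / 2 * ((b - a) / a * ∫ x, edgeEnergy G A Z a b e x ∂coinLaw G.edgeSet) := by
        rw [integral_const_mul]
        exact mul_le_mul_of_nonneg_left (h.integral_abs_discreteDeriv_le ha hab e) hhalf
    _ = (b - a) ^ 2 / (2 * a) * ∫ x, edgeEnergy G A Z a b e x ∂coinLaw G.edgeSet := by
        field_simp

theorem sum_integral_discreteDeriv_sq_le (h : IsNetwork G A Z) (ha : 0 < a) (hab : a ≤ b)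
    (s : Finset G.edgeSet) :
    ∑ e ∈ s, ∫ x, discreteDeriv e (coinEffectiveResistance G A Z a b) x ^ 2 ∂coinLaw G.edgeSet
      ≤ (b - a) ^ 2 / (2 * a)
        * ∫ x, coinEffectiveResistance G A Z a b x ∂coinLaw G.edgeSet := by
  refine (Finset.sum_le_sum fun e _ => h.integral_discreteDeriv_sq_le ha hab e).trans ?_
  rw [← Finset.mul_sum]
  exact mul_le_mul_of_nonneg_left (h.sum_integral_edgeEnergy_le ha hab s) (by positivity)

open Classical in
theorem sum_sq_integral_abs_discreteDeriv_le (h : IsNetwork G A Z) (ha : 0 < a) (hab : a ≤ b)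
    {S : Set G.edgeSet} (hS : Sᶜ.Finite) {α : ℝ} (hα0 : 0 ≤ α)
    (hα : ∀ e ∈ S, ∫ x, edgeEnergy G A Z a b e x ∂coinLaw G.edgeSet ≤ α) (s : Finset G.edgeSet) :
    ∑ e ∈ s, (∫ x, |discreteDeriv e (coinEffectiveResistance G A Z a b) x|
        ∂coinLaw G.edgeSet) ^ 2
      ≤ ((b - a) / a) ^ 2 * α * ∫ x, coinEffectiveResistance G A Z a b x ∂coinLaw G.edgeSet
        + (b - a) ^ 2 * Sᶜ.ncard := by
  have hnonneg (e : G.edgeSet) : 0 ≤ ∫ x,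
      |discreteDeriv e (coinEffectiveResistance G A Z a b) x| ∂coinLaw G.edgeSet :=
    integral_nonneg fun x => abs_nonneg _
  rw [← Finset.sum_filter_add_sum_filter_not s (· ∈ S)]
  refine add_le_add ?_ ?_
  · refine (Finset.sum_le_sum (g := fun e => ((b - a) / a) ^ 2 * α
      * ∫ x, edgeEnergy G A Z a b e x ∂coinLaw G.edgeSet) fun e he => ?_).trans ?_
    · refine (pow_le_pow_left₀ (hnonneg e) (h.integral_abs_discreteDeriv_le ha hab e) 2).trans ?_
      rw [mul_pow, mul_assoc, sq (∫ x, _ ∂_)]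
      gcongr
      · exact integral_nonneg (edgeEnergy_nonneg ha.le hab e)
      · exact hα e (Finset.mem_filter.1 he).2
    · rw [← Finset.mul_sum]
      exact mul_le_mul_of_nonneg_left (h.sum_integral_edgeEnergy_le ha hab _) (by positivity)
  · refine (Finset.sum_le_card_nsmul _ _ ((b - a) ^ 2) fun e _ => ?_).trans ?_
    · exact pow_le_pow_left₀ (hnonneg e)
        ((h.integral_abs_discreteDeriv_le_half ha hab e).trans (by linarith)) 2
    · rw [nsmul_eq_mul, mul_comm, Set.ncard_eq_toFinset_card _ hS]
      gcongr
      exact fun e he => by simpa using (Finset.mem_filter.1 he).2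

end Mean

end IsNetwork

end ElectricNetwork

namespace ElectricNetwork

open BooleanCube

/-- Take `c = v / (ε m)` if `v ≥ m K / log (K / ε)`; otherwise `v` is already small enough. -/
theorem le_div_log_of_forall_mul_one_add_log_le {v m K ε : ℝ} (hm : 0 < m) (hK : 0 < K)
    (hε : 0 ≤ ε) (hεK : Real.exp 1 * ε ≤ K) (hv : 0 ≤ v)
    (H : ∀ c, 0 < c → v * (1 + Real.log c) ≤ c * (ε * m) + 2 * (K * m)) :
    v ≤ 2 * K * m / Real.log (K / (ε * Real.log (K / ε))) := by
  rcases hε.eq_or_lt with rfl | hε0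
  · simp only [zero_mul, div_zero, Real.log_zero]
    by_contra! hlt
    have := H (Real.exp (2 * (K * m) / v)) (Real.exp_pos _)
    rw [Real.log_exp, mul_add, mul_div_cancel₀ _ hlt.ne'] at this
    linarith
  set L := Real.log (K / ε)
  have hL1 : 1 ≤ L :=
    (Real.le_log_iff_exp_le (by positivity)).2 ((le_div_iff₀ hε0).2 hεK)
  have hL0 : 0 < L := one_pos.trans_le hL1
  have hlogL : Real.log L ≤ L - 1 := Real.log_le_sub_one_of_pos hL0
  have hlogL0 : 0 ≤ Real.log L := Real.log_nonneg hL1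
  have hlog : Real.log (K / (ε * L)) = L - Real.log L := by
    rw [← div_div, Real.log_div (by positivity) hL0.ne']
  rw [hlog, le_div_iff₀ (by linarith)]
  rcases le_total (m * K / L) v with hlarge | hsmall
  · have hv0 : 0 < v := lt_of_lt_of_le (by positivity) hlarge
    have hle : L - Real.log L ≤ Real.log (v / (ε * m)) := by
      rw [← hlog]
      refine Real.log_le_log (by positivity) ?_
      calc K / (ε * L) = m * K / L / (ε * m) := by field_simp
        _ ≤ v / (ε * m) := by gcongr
    have := H (v / (ε * m)) (by positivity)
    rw [div_mul_cancel₀ _ (by positivity)] at this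
    linarith [mul_le_mul_of_nonneg_left hle hv]
  · rw [le_div_iff₀ hL0] at hsmall
    linarith [mul_nonneg hv hlogL0, mul_pos hm hK]

namespace IsNetwork

variable {V E : Type*} {G : Graph V E} {A Z : Finset V} {a b : ℝ}

theorem integral_edgeEnergy_le_iSup [Countable G.edgeSet] (h : IsNetwork G A Z) (ha : 0 < a)
    (hab : a ≤ b) {S : Set G.edgeSet} {e : G.edgeSet} (he : e ∈ S) :
    ∫ x, edgeEnergy G A Z a b e x ∂coinLaw G.edgeSet
      ≤ ⨆ e : S, ∫ x, edgeEnergy G A Z a b e x ∂coinLaw G.edgeSet := by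
  refine le_ciSup (f := fun e : S => ∫ x, edgeEnergy G A Z a b e x ∂coinLaw G.edgeSet)
    ⟨∫ x, coinEffectiveResistance G A Z a b x ∂coinLaw G.edgeSet, ?_⟩ ⟨e, he⟩
  rintro _ ⟨e', rfl⟩
  simpa using h.sum_integral_edgeEnergy_le ha hab {(e' : G.edgeSet)}

theorem variance_coinEffectiveResistance_le [Countable G.edgeSet] (h : IsNetwork G A Z)
    (ha : 0 < a) (hab : a ≤ b) {S : Set G.edgeSet} (hS : Sᶜ.Finite) {α ε K m : ℝ}
    (hα : α = ⨆ e : S, ∫ x, edgeEnergy G A Z a b e x ∂coinLaw G.edgeSet)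
    (hm : m = ∫ x, coinEffectiveResistance G A Z a b x ∂coinLaw G.edgeSet)
    (hε : ε = ((b - a) / a) ^ 2 * α + (b - a) ^ 2 * (Sᶜ.ncard / m))
    (hK : max ((b - a) ^ 2 / (2 * a)) (Real.exp 1) ≤ K) (hε1 : ε ≤ 1) :
    variance (coinEffectiveResistance G A Z a b) (coinLaw G.edgeSet)
      ≤ 2 * K * m / Real.log (K / (ε * Real.log (K / ε))) := by
  classical
  have hcont := h.continuous_coinEffectiveResistance ha hab
  have hm0 : 0 < m := hm ▸ h.integral_coinEffectiveResistance_pos ha hab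
  have hα0 : 0 ≤ α :=
    hα ▸ Real.iSup_nonneg fun e => integral_nonneg fun x => edgeEnergy_nonneg ha.le hab _ x
  have hεm : ((b - a) / a) ^ 2 * α * m + (b - a) ^ 2 * Sᶜ.ncard = ε * m := by
    rw [hε, add_mul, mul_assoc _ (_ / m), div_mul_cancel₀ _ hm0.ne']
  have hexp : Real.exp 1 ≤ K := (le_max_right _ _).trans hK
  refine le_div_log_of_forall_mul_one_add_log_le hm0 ((Real.exp_pos 1).trans_le hexp)
    (by rw [hε]; positivity) ((mul_le_of_le_one_right (Real.exp_pos 1).le hε1).trans hexp)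
    (variance_nonneg _ _) fun c hc => ?_
  rw [variance_eq_sub ((memLp_two_iff_integrable_sq hcont.aestronglyMeasurable).2
    (integrable_sq_of_continuous hcont))]
  refine integral_sq_sub_mul_one_add_log_le hcont (fun s => ?_) (fun s => ?_) hc
  · rw [← hεm, hm]
    exact h.sum_sq_integral_abs_discreteDeriv_le ha hab hS hα0
      (fun e he => hα ▸ h.integral_edgeEnergy_le_iSup ha hab he) s
  · rw [hm] at hm0 ⊢
    exact (h.sum_integral_discreteDeriv_sq_le ha hab s).trans
      (mul_le_mul_of_nonneg_right ((le_max_left _ _).trans hK) hm0.le)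

end IsNetwork

section Transfer

variable {ι Ω : Type*} [MeasurableSpace Ω] {P : Measure Ω} {r : ι → Ω → ℝ} {a b : ℝ}

theorem map_fairCoin (a b : ℝ) :
    fairCoin.map (fun c => bif c then b else a) = bernoulliLaw a b := by
  have hmeas : Measurable fun c : Bool => bif c then b else a := measurable_of_finite _
  rw [fairCoin, Measure.map_add _ _ hmeas, Measure.map_smul, Measure.map_smul,
    Measure.map_dirac' hmeas, Measure.map_dirac' hmeas]
  rfl

variable [Countable ι]

theorem identDistrib_coinResistance (hr : ∀ i, Measurable (r i))
    (hindep : iIndepFun r P) (hlaw : ∀ i, P.map (r i) = bernoulliLaw a b) :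
    IdentDistrib (fun ω i => r i ω) (coinResistance a b) P (coinLaw ι) where
  aemeasurable_fst := (measurable_pi_lambda _ hr).aemeasurable
  aemeasurable_snd := (continuous_coinResistance a b).measurable.aemeasurable
  map_eq := by
    rw [hindep.map_fun_eq_infinitePi_map hr]
    simp only [hlaw, ← map_fairCoin]
    exact (Measure.infinitePi_map_pi _ fun _ => measurable_of_finite _).symm

theorem ae_mem_Icc_of_identDistrib (hab : a ≤ b)
    (h : IdentDistrib (fun ω i => r i ω) (coinResistance a b) P (coinLaw ι)) :
    ∀ᵐ ω ∂P, ∀ i, r i ω ∈ Set.Icc a b := by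
  have := h.symm.ae_mem_snd (t := Set.univ.pi fun _ => Set.Icc a b)
    (MeasurableSet.univ_pi fun _ => measurableSet_Icc)
    (.of_forall fun x i _ => coinResistance_mem_Icc hab x i)
  exact this.mono fun ω hω i => hω i (Set.mem_univ i)

theorem identDistrib_comp_of_continuousOn {g : (ι → ℝ) → ℝ} (hab : a ≤ b)
    (hg : ContinuousOn g (Set.univ.pi fun _ => Set.Icc a b))
    (h : IdentDistrib (fun ω i => r i ω) (coinResistance a b) P (coinLaw ι)) :
    IdentDistrib (fun ω => g fun i => r i ω) (fun x => g (coinResistance a b x)) P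
      (coinLaw ι) := by
  have hbox : MeasurableSet (Set.univ.pi fun _ : ι => Set.Icc a b) :=
    MeasurableSet.univ_pi fun _ => measurableSet_Icc
  have hae : ∀ᵐ y ∂P.map (fun ω i => r i ω), y ∈ Set.univ.pi fun _ : ι => Set.Icc a b :=
    (ae_map_iff h.aemeasurable_fst hbox).2 <|
      (ae_mem_Icc_of_identDistrib hab h).mono fun ω hω i _ => hω i
  refine h.comp_of_aemeasurable ?_
  rw [← Measure.restrict_eq_self_of_ae_mem hae]
  exact hg.aemeasurable hbox

end Transfer

end ElectricNetwork

open ElectricNetwork BooleanCube in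
theorem proposition2 {V E : Type*} (G : Graph V E)
    (hV : G.vertexSet.Countable) (hG : ElectricNetwork.LocallyFinite G)
    (A Z : Finset V) (hAV : (A : Set V) ⊆ G.vertexSet) (hZV : (Z : Set V) ⊆ G.vertexSet)
    (hA : A.Nonempty) (hZ : Z.Nonempty) (hAZ : Disjoint A Z)
    -- there is a unit flow of finite energy from `A` to `Z`, i.e. the resistance is finite
    (hfin : ∃ θ, ElectricNetwork.IsFlow G A Z 1 θ ∧
      ElectricNetwork.energy G (fun _ => 1) θ ≠ ⊤)
    (a b : ℝ) (ha : 0 < a) (hab : a ≤ b)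
    {Ω : Type*} [MeasurableSpace Ω] (P : Measure Ω) [IsProbabilityMeasure P]
    (r : G.edgeSet → Ω → ℝ) (hr : ∀ e, Measurable (r e)) (hindep : iIndepFun r P)
    (hlaw : ∀ e, P.map (r e) = ElectricNetwork.bernoulliLaw a b)
    (Em : Set G.edgeSet) (hEm : Emᶜ.Finite)
    (f : Ω → ℝ) (hf : f = fun ω => ElectricNetwork.effectiveResistance G A Z (fun e => r e ω))
    (θ : Ω → G.edgeSet → ℝ)
    (hθ : θ = fun ω => ElectricNetwork.minimalFlow G A Z (fun e => r e ω))
    (α β ε K : ℝ)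
    (hα : α = ⨆ e : Em, ∫ ω, r e ω * θ ω e ^ 2 ∂P)
    (hβ : β = (Emᶜ.ncard : ℝ) / ∫ ω, f ω ∂P)
    (hε : ε = ((b - a) / a) ^ 2 * α + (b - a) ^ 2 * β)
    (hK : K = max ((b - a) ^ 2 / (2 * a)) (Real.exp 1))
    (hε1 : ε < 1) :
    -- the quantities above are well defined ...
    (∀ᵐ ω ∂P, ElectricNetwork.IsMinimalFlow G A Z (fun e => r e ω) (θ ω)) ∧
    (∀ e, Integrable (fun ω => r e ω * θ ω e ^ 2) P) ∧
    MemLp f 2 P ∧ 0 < ∫ ω, f ω ∂P ∧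
    -- ... and the variance bound holds; for `a = b` one has `ε = 0` and both sides are `0`
    variance f P ≤ 2 * K * (∫ ω, f ω ∂P) / Real.log (K / (ε * Real.log (K / ε))) := by
  have : Countable G.edgeSet := countable_edgeSet hV hG
  have hN : IsNetwork G A Z := by
    obtain ⟨φ, hφ, hφe⟩ := hfin
    exact ⟨hG, hAZ, hA, hZ, φ, hφ, by
      simpa using summable_of_energy_ne_top (fun _ => zero_le_one) hφe⟩
  have hcoins := identDistrib_coinResistance hr hindep hlaw
  have hfcoin : IdentDistrib f (coinEffectiveResistance G A Z a b) P (coinLaw G.edgeSet) :=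
    hf ▸ identDistrib_comp_of_continuousOn hab (hN.continuousOn_effectiveResistance ha) hcoins
  have hecoin (e : G.edgeSet) : IdentDistrib (fun ω => r e ω * θ ω e ^ 2)
      (edgeEnergy G A Z a b e) P (coinLaw G.edgeSet) :=
    hθ ▸ identDistrib_comp_of_continuousOn hab
      ((continuous_apply e).continuousOn.mul ((hN.continuousOn_minimalFlow ha e).pow 2)) hcoins
  refine ⟨?_, fun e => ?_, ?_, ?_, ?_⟩
  · filter_upwards [ae_mem_Icc_of_identDistrib hab hcoins] with ω hω
    exact hθ ▸ (hN.isCurrent_minimalFlow ha hω).isMinimalFlow fun e => ha.le.trans (hω e).1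
  · exact (hecoin e).integrable_iff.2 (integrable_of_continuous (hN.continuous_edgeEnergy ha hab e))
  · have hF := hN.continuous_coinEffectiveResistance ha hab
    exact hfcoin.memLp_iff.2 ((memLp_two_iff_integrable_sq hF.aestronglyMeasurable).2
      (integrable_sq_of_continuous hF))
  · exact hfcoin.integral_eq ▸ hN.integral_coinEffectiveResistance_pos ha hab
  · rw [hfcoin.variance_eq]
    simp only [(hecoin _).integral_eq] at hα
    exact hN.variance_coinEffectiveResistance_le ha hab hEm hα hfcoin.integral_eq (hβ ▸ hε) hK.ge
      hε1.le
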